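/- **Conventions.** A dyadic interval is $[j2^k,(j+1)2^k)$ with $j,k\in\mathbb Z$; $c(I)$ and $|I|$ are the midpoint and the length of $I$, $CI$ is the dilation of $I$ by the factor $C$ about its center, and $I+\alpha=\{x+\alpha:x\in I\}$. A tile is a rectangle $P=I_P\times\omega_P$ of area $1$ with $I_P,\omega_P$ dyadic. A finite collection $\mathbf P$ of tiles is sparse relative to $C_0\ge 1$ if for all $Q,R\in\mathbf P$ with $|I_R|/C_0\le|I_Q|\le|I_R|$ one has $|I_Q|=|I_R|$, and moreover $\omega_Q=\omega_R$ or $C_0\omega_Q\cap C_0\omega_R=\emptyset$. Fix an integer $n$ and put $\omega_{P,upper}=\omega_P+n|\omega_P|$; assume that $1000\,\omega_P$ lies strictly below $\omega_{P,upper}$. Let $\widetilde\omega_P$ be the convex hull of $50\,\omega_P\cup 50\,\omega_{P,upper}$. Functions $(\phi_P)_{P\in\mathbf P}$ are $L^1$-normalized wave packets with constants $A=(A_{k,N})_{k,N\ge0}$ if each $\phi_P$ is smooth, $\widehat{\phi_P}(\xi)=(2\pi)^{-1/2}\int\phi_P(x)e^{-ix\xi}\,dx$ is supported in $\frac54\omega_P$,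 and for all $k,N\ge0$ and $x\in\mathbb R$ $$\Big|\frac{d^k}{dx^k}\big(e^{-ic(\omega_P)x}\phi_P(x)\big)\Big|\le A_{k,N}\,|I_P|^{-k-1}\Big(1+\frac{|x-c(I_P)|}{|I_P|}\Big)^{-N}.$$ Put $T_1f(P)=\langle f,\phi_P\rangle=\int f\,\overline{\phi_P}$. A nonempty $E\subset\mathbf P$ is generating, with data a dyadic interval $I_E$ and $\xi_E\in\mathbb R$, if $I_P\subset I_E$ and $(\xi_E-\frac1{2|I_E|},\xi_E+\frac1{2|I_E|})\subset\widetilde\omega_P$ for all $P\in E$; it is lacunary, with these data, if also $\xi_E\in50\,\omega_{P,upper}$ for all $P\in E$. Let $\mu(F)=\inf\sum_j|I_{E_j}|$ over all countable coverings of $F\subset\mathbf P$ by generating sets $E_j$ (with data). For $g:\mathbf P\to\mathbb C$ and $E$ generating let $$S_{2,lac}(g)(E)=\sup_{S\subset E\ \text{lacunary}}\Big(\frac1{|I_S|}\sum_{P\in S}|g(P)|^2|I_P|\Big)^{1/2},$$ the supremum being taken over $S$ and its data. Put $\|g\|_{\mathcal L^\infty(\mathbf P,S_{2,lac},\mu)}=\sup_{E\text{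 generating}}S_{2,lac}(g)(E)$, let $\mu(S_{2,lac}(g)>\lambda)$ be the infimum of $\mu(F)$ over all $F\subset\mathbf P$ with $\|g1_{\mathbf P\setminus F}\|_{\mathcal L^\infty}\le\lambda$, and for $0<p<\infty$ put $$\|g\|_{\mathcal L^{p}}=\Big(p\int_0^\infty\lambda^{p-1}\mu(S_{2,lac}(g)>\lambda)\,d\lambda\Big)^{1/p},\qquad \|g\|_{\mathcal L^{p,\infty}}=\sup_{\lambda>0}\lambda\,\mu(S_{2,lac}(g)>\lambda)^{1/p}.$$ **Theorem.** There is $C_0\ge1$, depending only on $n$, such that for every choice of constants $A=(A_{k,N})$ the following holds. 1. For every $2<p\le\infty$ there is $C<\infty$, depending only on $n$, $A$ and $p$, such that for every finite collection $\mathbf P$ of tiles that is sparse relative to $C_0$, all $L^1$-normalized wave packets $(\phi_P)_{P\in\mathbf P}$ with constants $A$, and all $f\in L^p(\mathbb R)$, $$\|T_1f\|_{\mathcal L^p(\mathbf P,S_{2,lac},\mu)}\le C\|f\|_{L^p(\mathbb R)}.$$ 2. There is $C<\infty$, depending only on $n$ and $A$, such that for all such $\mathbf P$ and $(\phi_P)$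 and all $f\in L^2(\mathbb R)$, $$\|T_1f\|_{\mathcal L^{2,\infty}(\mathbf P,S_{2,lac},\mu)}\le C\|f\|_{L^2(\mathbb R)}.$$ -/

import Mathlib

open MeasureTheory
open scoped ENNReal NNReal

noncomputable section

/-! ### Outer measure spaces and outer `L^p` norms

A size on a set `X`, relative to a collection `𝓔` of subsets of `X`, assigns to a function
`f : X → ℂ` and a set `E ∈ 𝓔` a number `S f E ∈ [0, ∞]`. -/

namespace OuterLp

variable {X : Type*}

/-- The outer supremum `outsup_X S(f) = sup_{E ∈ 𝓔} S(f)(E)`. -/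
def outSup (𝓔 : Set (Set X)) (S : (X → ℂ) → Set X → ℝ≥0∞) (f : X → ℂ) : ℝ≥0∞ :=
  ⨆ E ∈ 𝓔, S f E

/-- `μ(S(f) > t)`: the infimum of `μ(F)` over all `F ⊆ X` such that
`outsup_{X \ F} S(f) = outsup_X S(f 1_{X \ F}) ≤ t`. -/
def superLevel (μ : OuterMeasure X) (𝓔 : Set (Set X)) (S : (X → ℂ) → Set X → ℝ≥0∞)
    (f : X → ℂ) (t : ℝ≥0∞) : ℝ≥0∞ :=
  ⨅ (F : Set X) (_ : outSup 𝓔 S (Fᶜ.indicator f) ≤ t), μ F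

/-- The outer `L^p` norm, `0 < p ≤ ∞`:
`(p ∫_0^∞ t^{p-1} μ(S(f) > t) dt)^{1/p}` for `p < ∞`, the outer supremum for `p = ∞`. -/
def strongNorm (μ : OuterMeasure X) (𝓔 : Set (Set X)) (S : (X → ℂ) → Set X → ℝ≥0∞)
    (p : ℝ≥0∞) (f : X → ℂ) : ℝ≥0∞ :=
  if p = ∞ then outSup 𝓔 S f
  else (p * ∫⁻ t in Set.Ioi (0 : ℝ),
    ENNReal.ofReal (t ^ (p.toReal - 1)) * superLevel μ 𝓔 S f (ENNReal.ofReal t)) ^ (1 / p.toReal)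

/-- The outer weak `L^p` norm, `0 < p < ∞`: `sup_{t > 0} t μ(S(f) > t)^{1/p}`. -/
def weakNorm (μ : OuterMeasure X) (𝓔 : Set (Set X)) (S : (X → ℂ) → Set X → ℝ≥0∞)
    (p : ℝ) (f : X → ℂ) : ℝ≥0∞ :=
  ⨆ (t : ℝ) (_ : 0 < t),
    ENNReal.ofReal t * superLevel μ 𝓔 S f (ENNReal.ofReal t) ^ (1 / p)

end OuterLp

/-! ### Dyadic intervals and tiles -/

/-- The dyadic interval `[index * 2^scale, (index + 1) * 2^scale)`. -/
structure DyadicInterval where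
  scale : ℤ
  index : ℤ

namespace DyadicInterval

/-- The length `|I|`. -/
def length (I : DyadicInterval) : ℝ := (2 : ℝ) ^ I.scale

/-- The midpoint `c(I)`. -/
def center (I : DyadicInterval) : ℝ := ((I.index : ℝ) + 1 / 2) * I.length

/-- The points of the interval. -/
def toSet (I : DyadicInterval) : Set ℝ :=
  Set.Ico ((I.index : ℝ) * I.length) (((I.index : ℝ) + 1) * I.length)

/-- `C I`: the dilation of `I` by the factor `C` about its center. -/
def dilate (I : DyadicInterval) (C : ℝ) : Set ℝ :=
  Set.Ico (I.center - C / 2 * I.length) (I.center + C / 2 * I.length)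

/-- The translate `I + n |I|`. -/
def translate (I : DyadicInterval) (n : ℤ) : DyadicInterval := ⟨I.scale, I.index + n⟩

end DyadicInterval

/-- A (standard) tile `I_P × ω_P`: a product of two dyadic intervals, of area `1`. -/
structure Tile where
  /-- the spatial interval `I_P` -/
  space : DyadicInterval
  /-- the frequency interval `ω_P` -/
  freq : DyadicInterval
  area : space.length * freq.length = 1

namespace Tile

/-- The finite upper interval `ω_{P,upper} = ω_P + n |ω_P|` of a rigid triple with parameter `n`. -/
def upper (n : ℤ) (P : Tile) : DyadicInterval := P.freq.translate n

/-- `ω̃_P`: the convex hull of `50 ω_P` and `50 ω_{P,upper}`. -/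
def hull (n : ℤ) (P : Tile) : Set ℝ :=
  convexHull ℝ (P.freq.dilate 50 ∪ (P.upper n).dilate 50)

end Tile

/-- A tile collection is sparse relative to `C₀` if for all members `Q`, `R` with
`|I_R| / C₀ ≤ |I_Q| ≤ |I_R|` one has `|I_Q| = |I_R|` and, moreover,
`ω_Q = ω_R` or `C₀ ω_Q ∩ C₀ ω_R = ∅`. -/
def IsSparse (C₀ : ℝ) (T : Finset Tile) : Prop :=
  ∀ Q ∈ T, ∀ R ∈ T, R.space.length / C₀ ≤ Q.space.length → Q.space.length ≤ R.space.length →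
    Q.space.length = R.space.length ∧
      (Q.freq = R.freq ∨ Q.freq.dilate C₀ ∩ R.freq.dilate C₀ = ∅)

/-! ### Wave packets and the coefficient map -/

/-- The Fourier transform with the normalization `(2π)^{-1/2} ∫ f(x) e^{-ixξ} dx`. -/
def angularFourier (f : ℝ → ℂ) (ξ : ℝ) : ℂ :=
  (((2 * Real.pi) ^ (-(1 / 2) : ℝ) : ℝ) : ℂ) *
    ∫ x : ℝ, f x * Complex.exp (-(Complex.I * (x : ℂ) * (ξ : ℂ)))

/-- `(φ_P)_{P ∈ T}` is an `L¹`-normalized wave packet collection, with constants `A k N`: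
the Fourier transform of `φ_P` is supported in `(5/4) ω_P`, and the `k`-th derivative of
`e^{-i c(ω_P) x} φ_P(x)` is at most `A k N |I_P|^{-(k+1)} (1 + |x - c(I_P)| / |I_P|)^{-N}`,
for all `k, N ≥ 0`. -/
structure IsWavePackets (A : ℕ → ℕ → ℝ) (T : Finset Tile) (φ : Tile → ℝ → ℂ) : Prop where
  smooth : ∀ P ∈ T, ContDiff ℝ (⊤ : ℕ∞) (φ P)
  freq_support : ∀ P ∈ T, ∀ ξ : ℝ, ξ ∉ P.freq.dilate (5 / 4) → angularFourier (φ P) ξ = 0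
  bound : ∀ P ∈ T, ∀ (k N : ℕ) (x : ℝ),
    ‖iteratedDeriv k
        (fun y : ℝ => Complex.exp (-(Complex.I * (P.freq.center : ℂ) * (y : ℂ))) * φ P y) x‖ ≤
      A k N / P.space.length ^ (k + 1) *
        ((1 + |x - P.space.center| / P.space.length) ^ N)⁻¹

/-- The coefficient map `T₁ f (P) = ⟨f, φ_P⟩ = ∫ f(x) conj(φ_P(x)) dx` on the tiles of `T`. -/
def waveCoeff (T : Finset Tile) (φ : Tile → ℝ → ℂ) (f : ℝ → ℂ) (P : T) : ℂ :=
  ∫ x : ℝ, f x * (starRingEnd ℂ) (φ P.1 x)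

/-! ### The outer measure space on a finite tile collection -/

namespace TileSpace

/-- `E` is a generating set, as witnessed by the dyadic interval `I = I_E` and `ξ = ξ_E`. -/
structure IsGenerating (n : ℤ) (T : Finset Tile) (E : Set T) (I : DyadicInterval) (ξ : ℝ) :
    Prop where
  nonempty : E.Nonempty
  space_subset : ∀ P ∈ E, P.1.space.toSet ⊆ I.toSet
  freq_subset : ∀ P ∈ E,
    Set.Ioo (ξ - 1 / (2 * I.length)) (ξ + 1 / (2 * I.length)) ⊆ P.1.hull n

/-- `E` is a lacunary generating set, as witnessed by `I = I_E` and `ξ = ξ_E`. -/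
structure IsLacunary (n : ℤ) (T : Finset Tile) (E : Set T) (I : DyadicInterval) (ξ : ℝ) :
    Prop extends IsGenerating n T E I ξ where
  mem_upper : ∀ P ∈ E, ξ ∈ (P.1.upper n).dilate 50

/-- The collection of generating subsets. -/
def generating (n : ℤ) (T : Finset Tile) : Set (Set T) :=
  {E | ∃ (I : DyadicInterval) (ξ : ℝ), IsGenerating n T E I ξ}

open Classical in
/-- The premeasure `E ↦ |I_E|` (the infimum over the admissible `I_E`) on generating sets; it is
`0` on the empty set and `∞` on the other sets, which are not to be used in coverings. -/
def premeasure (n : ℤ) (T : Finset Tile) (E : Set T) : ℝ≥0∞ :=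
  if E = ∅ then 0
  else ⨅ (I : DyadicInterval) (ξ : ℝ) (_ : IsGenerating n T E I ξ), ENNReal.ofReal I.length

/-- The outer measure `μ(E) = inf ∑_j |I_{E_j}|` over countable coverings of `E` by generating
sets `E_j`. -/
def outerMeas (n : ℤ) (T : Finset Tile) : OuterMeasure T :=
  OuterMeasure.ofFunction (premeasure n T) (by simp [premeasure])

/-- The lacunary size
`S_{t,lac}(f)(E) = sup_S (|I_S|^{-1} ∑_{P ∈ S} |f(P)|^t |I_P|)^{1/t}`, with the supremum over
the lacunary subsets `S ⊆ E`. -/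
def sizeLac (n : ℤ) (T : Finset Tile) (t : ℝ) (f : T → ℂ) (E : Set T) : ℝ≥0∞ :=
  ⨆ (S : Set T) (_ : S ⊆ E) (I : DyadicInterval) (ξ : ℝ) (_ : IsLacunary n T S I ξ),
    ((ENNReal.ofReal I.length)⁻¹ *
      ∑' P : S, ‖f P.1‖ₑ ^ t * ENNReal.ofReal P.1.1.space.length) ^ (1 / t)

end TileSpace

end

/-!
The coefficients `⟨f, φ_P⟩` enter only through three facts about wave packets: decay of order six
away from `I_P`, frequency support in `(5/4) ω_P`, and Plancherel's theorem. The constants depend on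
the wave packet constants through `A 0 6`.

With `C₀ = n + 100`, the doubled frequency intervals of tiles of different scales in a lacunary set
("tree") are disjoint, because each lies at distance about `n |ω_P|` from the top frequency, and
tiles of equal scale have equal frequency intervals, hence disjoint spatial intervals. The wave
packets of a tree are thus orthogonal across scales and almost orthogonal within a scale, and a
`T T^*` argument gives the Bessel inequality `Tree.Lac.energy_le`. Splitting a bounded function at
three times the top interval turns this into the estimate for `p = ∞`
(`Tree.Lac.energy_le_of_bound`).

For the weak type estimate at height `λ`, trees of mean energy more than `λ²` are selected greedily,
each with almost minimal top frequency, and together with each tree the whole generating set with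
the same top data is removed (`exists_forest`). If the frequency interval of a tile `P` of a
selected tree meets that of a shorter tile `Q` of another one, then the first tree has the smaller
top frequency, was therefore selected earlier, and `Q` must lie outside its top interval, or it
would have been removed. So the cross terms in the `T T^*` argument for the union of the selected
trees only see tails of wave packets outside top intervals (`IsForest.crossTerms_le`), and the total
length of the top intervals is `O(λ⁻² ‖f‖₂²)` (`IsForest.sum_top_le`). This uses that single
coefficients are at most `2 λ`, which is arranged by descending from large heights in dyadic steps
(`exists_covered`).

The range `2 < p < ∞` follows by splitting `f` at a height proportional to `λ`
(`superLevel_le_lintegral`) and integrating with the layer cake formula.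
-/

noncomputable section

namespace TileEmbedding

section

/-! ### Dyadic intervals -/

lemma length_pos (I : DyadicInterval) : 0 < I.length := by
  unfold DyadicInterval.length; positivity

lemma scale_eq_of_length_eq {I J : DyadicInterval} (h : I.length = J.length) :
    I.scale = J.scale :=
  zpow_right_injective₀ (by norm_num) (by norm_num) h

lemma mem_toSet {I : DyadicInterval} {x : ℝ} :
    x ∈ I.toSet ↔ I.center - I.length / 2 ≤ x ∧ x < I.center + I.length / 2 := by
  simp only [DyadicInterval.toSet, DyadicInterval.center, Set.mem_Ico]
  constructor <;> rintro ⟨h1, h2⟩ <;> constructor <;> linarith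

lemma center_mem (I : DyadicInterval) : I.center ∈ I.toSet := by
  rw [mem_toSet]; have := length_pos I; constructor <;> linarith

lemma mem_dilate {I : DyadicInterval} {C x : ℝ} :
    x ∈ I.dilate C ↔ I.center - C / 2 * I.length ≤ x ∧ x < I.center + C / 2 * I.length := by
  simp [DyadicInterval.dilate]

lemma dilate_mono (I : DyadicInterval) {a b : ℝ} (h : a ≤ b) : I.dilate a ⊆ I.dilate b := by
  intro x hx
  rw [mem_dilate] at hx ⊢
  have := mul_le_mul_of_nonneg_right (show a / 2 ≤ b / 2 by linarith) (length_pos I).le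
  constructor <;> linarith [hx.1, hx.2]

/-- A dyadic interval that meets another one of at least its length is contained in it. -/
lemma subset_of_inter {I J : DyadicInterval} (hl : I.length ≤ J.length)
    {x : ℝ} (hI : x ∈ I.toSet) (hJ : x ∈ J.toSet) : I.toSet ⊆ J.toSet := by
  have hs : I.scale ≤ J.scale := (zpow_le_zpow_iff_right₀ (by norm_num : (1 : ℝ) < 2)).1 hl
  obtain ⟨k, hk⟩ := Int.eq_ofNat_of_zero_le (sub_nonneg.2 hs)
  have hlen : J.length = ((2 ^ k : ℤ) : ℝ) * I.length := by
    unfold DyadicInterval.length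
    rw [show J.scale = (k : ℤ) + I.scale by omega, zpow_add₀ (by norm_num)]
    push_cast; simp
  have hp := length_pos I
  have hm : (0 : ℤ) < 2 ^ k := by positivity
  set m : ℤ := 2 ^ k
  simp only [DyadicInterval.toSet, Set.mem_Ico] at hI hJ ⊢
  rw [hlen] at hJ ⊢
  have h1 : J.index * m < I.index + 1 := by
    have : ((J.index : ℝ) * m) * I.length < ((I.index : ℝ) + 1) * I.length := by
      calc _ = (J.index : ℝ) * (m * I.length) := by ring
        _ ≤ x := hJ.1
        _ < _ := hI.2
    exact_mod_cast lt_of_mul_lt_mul_right this hp.le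
  have h2 : I.index < (J.index + 1) * m := by
    have : (I.index : ℝ) * I.length < (((J.index : ℝ) + 1) * m) * I.length := by
      calc _ ≤ x := hI.1
        _ < _ := hJ.2
        _ = _ := by ring
    exact_mod_cast lt_of_mul_lt_mul_right this hp.le
  have h1' : (J.index : ℝ) * m ≤ I.index := by exact_mod_cast Int.lt_add_one_iff.1 h1
  have h2' : (I.index : ℝ) + 1 ≤ (J.index + 1) * m := by exact_mod_cast h2
  apply Set.Ico_subset_Ico
  · calc (J.index : ℝ) * (m * I.length) = (J.index * m) * I.length := by ring
      _ ≤ _ := mul_le_mul_of_nonneg_right h1' hp.le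
  · calc _ ≤ ((J.index + 1) * m : ℝ) * I.length := mul_le_mul_of_nonneg_right h2' hp.le
      _ = _ := by ring

lemma length_le_of_subset {I J : DyadicInterval} (h : I.toSet ⊆ J.toSet) :
    I.length ≤ J.length := by
  have hp := length_pos I
  have hv : volume I.toSet ≤ volume J.toSet := measure_mono h
  simp only [DyadicInterval.toSet, Real.volume_Ico] at hv
  have e : ∀ K : DyadicInterval, ((K.index : ℝ) + 1) * K.length - K.index * K.length = K.length :=
    fun K => by ring
  rw [e, e] at hv
  exact (ENNReal.ofReal_le_ofReal_iff (length_pos J).le).1 hv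

lemma disjoint_of_length_eq {I J : DyadicInterval} (hl : I.length = J.length) (hne : I ≠ J) :
    Disjoint I.toSet J.toSet := by
  rw [Set.disjoint_left]
  intro x hI hJ
  apply hne
  have hs := scale_eq_of_length_eq hl
  have hc : I.toSet = J.toSet :=
    (subset_of_inter hl.le hI hJ).antisymm (subset_of_inter hl.ge hJ hI)
  have hp := length_pos I
  have h1 : J.index = I.index := by
    have := (Set.Ico_eq_Ico_iff (Or.inl (by nlinarith))).1 hc
    have h := this.1
    rw [← hl] at h
    exact_mod_cast (mul_right_cancel₀ hp.ne' h).symm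
  cases I; cases J; simp_all

/-! ### Tiles in a sparse collection -/

lemma Tile.freq_length (P : Tile) : P.freq.length = 1 / P.space.length := by
  have := P.area
  have h := length_pos P.space
  field_simp; linarith

lemma Tile.ext_of {P Q : Tile} (h1 : P.space = Q.space) (h2 : P.freq = Q.freq) : P = Q := by
  cases P; cases Q; simp_all

lemma upper_length (n : ℤ) (P : Tile) : (P.upper n).length = P.freq.length := rfl

lemma upper_center (n : ℤ) (P : Tile) :
    (P.upper n).center = P.freq.center + n * P.freq.length := by
  simp only [Tile.upper, DyadicInterval.center, DyadicInterval.translate, DyadicInterval.length]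
  push_cast; ring

/-- The gap condition `1000 ω_P < ω_{P,upper}` is a lower bound on `n`. -/
lemma gap_le (n : ℤ) (hn : ∀ P : Tile, ∀ x ∈ P.freq.dilate 1000, ∀ y ∈ (P.upper n).toSet, x < y) :
    (501 : ℝ) ≤ n := by
  have h := hn ⟨⟨0, 0⟩, ⟨0, 0⟩, by simp [DyadicInterval.length]⟩ (500 + 1 / 4)
    (by rw [mem_dilate]; simp [DyadicInterval.length, DyadicInterval.center]; norm_num) n
    (by rw [mem_toSet, upper_center, upper_length]
        simp [DyadicInterval.length, DyadicInterval.center]; linarith)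
  have : (500 : ℤ) < n := by
    have : (500 : ℝ) < n := by linarith
    exact_mod_cast this
  exact_mod_cast this

variable {C₀ : ℝ} {T : Finset Tile}

/-- In a sparse collection, different scales are separated by the factor `C₀`. -/
lemma freq_length_lt (hC : 0 < C₀) (hT : IsSparse C₀ T) {P Q : Tile} (hP : P ∈ T) (hQ : Q ∈ T)
    (h : Q.space.length < P.space.length) : C₀ * P.freq.length < Q.freq.length := by
  have hlt : Q.space.length < P.space.length / C₀ := by
    by_contra hcon
    exact h.ne (hT Q hQ P hP (not_lt.1 hcon) h.le).1
  have hp := length_pos P.space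
  have hq := length_pos Q.space
  rw [Tile.freq_length, Tile.freq_length, mul_one_div, div_lt_div_iff₀ hp hq]
  rw [lt_div_iff₀ hC] at hlt
  linarith

lemma freq_eq_of_inter (hC : 1 ≤ C₀) (hT : IsSparse C₀ T) {P Q : Tile} (hP : P ∈ T) (hQ : Q ∈ T)
    (h : Q.space.length = P.space.length) {x : ℝ} (hxP : x ∈ P.freq.dilate C₀)
    (hxQ : x ∈ Q.freq.dilate C₀) : P.freq = Q.freq := by
  have hp := length_pos P.space
  rcases (hT P hP Q hQ (by rw [h]; exact div_le_self hp.le hC) h.ge).2 with h1 | h1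
  · exact h1
  · exact absurd (show x ∈ P.freq.dilate C₀ ∩ Q.freq.dilate C₀ from ⟨hxP, hxQ⟩) (by simp [h1])

lemma disjoint_of_freq_eq {P Q : Tile} (hne : P ≠ Q) (hf : P.freq = Q.freq) :
    Disjoint P.space.toSet Q.space.toSet := by
  refine disjoint_of_length_eq ?_ fun h => hne (Tile.ext_of h hf)
  have hp := P.area
  have hq := Q.area
  rw [hf] at hp
  exact mul_right_cancel₀ (length_pos Q.freq).ne' (hp.trans hq.symm)

/-! ### Trees -/

/-- A finite set of tiles with top data, that is, an interval and a frequency. That the tiles form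
a lacunary set with these data is the separate condition `Tree.Lac`. -/
structure Tree where
  tiles : Finset Tile
  top : DyadicInterval
  xi : ℝ

/-- The conditions on a tile to belong to the generating set with top data `I`, `ξ`. -/
def Below (n : ℤ) (I : DyadicInterval) (ξ : ℝ) (P : Tile) : Prop :=
  P.space.toSet ⊆ I.toSet ∧
    Set.Ioo (ξ - 1 / (2 * I.length)) (ξ + 1 / (2 * I.length)) ⊆ P.hull n

/-- The tiles of `t` form a lacunary set with top data `t.top`, `t.xi`. The empty set of tiles is
admitted. -/
def Tree.Lac (n : ℤ) (t : Tree) : Prop :=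
  ∀ P ∈ t.tiles, Below n t.top t.xi P ∧ t.xi ∈ (P.upper n).dilate 50

lemma Tree.Lac.length_le {n : ℤ} {t : Tree} (ht : t.Lac n) {P : Tile} (hP : P ∈ t.tiles) :
    P.space.length ≤ t.top.length := length_le_of_subset (ht P hP).1.1

lemma Tree.Lac.xi_bounds {n : ℤ} {t : Tree} (ht : t.Lac n) {P : Tile} (hP : P ∈ t.tiles) :
    P.freq.center + (n - 25) * P.freq.length ≤ t.xi ∧
      t.xi ≤ P.freq.center + (n + 25) * P.freq.length := by
  have := mem_dilate.1 (ht P hP).2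
  rw [upper_center, upper_length] at this
  constructor <;> linarith [this.1, this.2]

lemma center_dist_of_meet {P Q : Tile} {a b x : ℝ} (hP : x ∈ P.freq.dilate a)
    (hQ : x ∈ Q.freq.dilate b) :
    P.freq.center - Q.freq.center ≤ a / 2 * P.freq.length + b / 2 * Q.freq.length ∧
      Q.freq.center - P.freq.center ≤ a / 2 * P.freq.length + b / 2 * Q.freq.length := by
  rw [mem_dilate] at hP hQ
  constructor <;> linarith [hP.1, hP.2, hQ.1, hQ.2]

variable {n : ℤ}

/-- Within a tree, the doubled frequency intervals of tiles of different scales are disjoint: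
they sit at a distance from the top frequency comparable to their length. -/
lemma Tree.Lac.not_meet (hn : (501 : ℝ) ≤ n) (hC : (n : ℝ) + 100 ≤ C₀) (hT : IsSparse C₀ T)
    {t : Tree} (ht : t.Lac n) (htT : t.tiles ⊆ T) {P Q : Tile} (hP : P ∈ t.tiles)
    (hQ : Q ∈ t.tiles) (h : Q.space.length < P.space.length) {x : ℝ}
    (hxP : x ∈ P.freq.dilate 2) (hxQ : x ∈ Q.freq.dilate 2) : False := by
  have h1 := freq_length_lt (by linarith) hT (htT hP) (htT hQ) h
  have h2 := (ht.xi_bounds hP).2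
  have h3 := (ht.xi_bounds hQ).1
  have h4 := center_dist_of_meet hxP hxQ
  have hp := length_pos P.freq
  have h5 : (n - 26 : ℝ) * Q.freq.length ≤ (n + 26) * P.freq.length := by linarith [h4.1, h4.2]
  nlinarith

lemma Tree.Lac.freq_eq (hn : (501 : ℝ) ≤ n) (hC : (n : ℝ) + 100 ≤ C₀) (hT : IsSparse C₀ T)
    {t : Tree} (ht : t.Lac n) (htT : t.tiles ⊆ T) {P Q : Tile} (hP : P ∈ t.tiles)
    (hQ : Q ∈ t.tiles) (h : Q.space.length = P.space.length) : P.freq = Q.freq := by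
  have hl : Q.freq.length = P.freq.length := by rw [Tile.freq_length, Tile.freq_length, h]
  have hp := length_pos P.freq
  have h1 := ht.xi_bounds hP
  have h2 := ht.xi_bounds hQ
  rw [hl] at h2
  refine freq_eq_of_inter (by linarith) hT (htT hP) (htT hQ) h (x := P.freq.center) ?_ ?_
  · rw [mem_dilate]; constructor <;> nlinarith
  · rw [mem_dilate, hl]
    constructor <;> nlinarith [h1.1, h1.2, h2.1, h2.2]

lemma Tree.Lac.disjoint (hn : (501 : ℝ) ≤ n) (hC : (n : ℝ) + 100 ≤ C₀) (hT : IsSparse C₀ T)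
    {t : Tree} (ht : t.Lac n) (htT : t.tiles ⊆ T) {P Q : Tile} (hP : P ∈ t.tiles)
    (hQ : Q ∈ t.tiles) (h : Q.space.length = P.space.length) (hne : P ≠ Q) :
    Disjoint P.space.toSet Q.space.toSet :=
  disjoint_of_freq_eq hne (ht.freq_eq hn hC hT htT hP hQ h)

/-- If the frequency interval of a tile `P` of a tree meets that of a much shorter tile `Q`, then
the top frequency of the tree lies near the frequency interval of `Q`, below the upper interval
of `Q`. -/
lemma Tree.Lac.xi_near (hn : (501 : ℝ) ≤ n) (hC : (n : ℝ) + 100 ≤ C₀) (hT : IsSparse C₀ T)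
    {t : Tree} (ht : t.Lac n) (htT : t.tiles ⊆ T) {P Q : Tile} (hP : P ∈ t.tiles)
    (hQ : Q ∈ T) (h : Q.space.length < P.space.length) {x : ℝ}
    (hxP : x ∈ P.freq.dilate 2) (hxQ : x ∈ Q.freq.dilate 2) :
    t.xi ≤ Q.freq.center + 2 * Q.freq.length ∧
      Set.Ioo (t.xi - 1 / (2 * t.top.length)) (t.xi + 1 / (2 * t.top.length)) ⊆ Q.hull n := by
  have h1 := freq_length_lt (by linarith) hT (htT hP) hQ h
  have h2 := ht.xi_bounds hP
  have h4 := center_dist_of_meet hxP hxQ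
  have hp := length_pos P.freq
  have hq := length_pos Q.freq
  have h5 : ((n : ℝ) + 100) * P.freq.length ≤ Q.freq.length :=
    (mul_le_mul_of_nonneg_right hC hp.le).trans h1.le
  have h6 : 1 / (2 * t.top.length) ≤ P.freq.length := by
    rw [Tile.freq_length]
    apply one_div_le_one_div_of_le (length_pos _)
    linarith [ht.length_le hP, length_pos t.top]
  refine ⟨by nlinarith [h2.2, h4.1, h4.2], ?_⟩
  intro y hy
  apply subset_convexHull
  left
  rw [mem_dilate]
  constructor
  · nlinarith [h2.1, h2.2, h4.1, h4.2, hy.1, hy.2]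
  · nlinarith [h2.1, h2.2, h4.1, h4.2, hy.1, hy.2]

/-- A single tile is a tree. -/
lemma lac_singleton (n : ℤ) (P : Tile) :
    Tree.Lac n ⟨{P}, P.space, P.freq.center + n * P.freq.length⟩ := by
  intro Q hQ
  obtain rfl : Q = P := by simpa using hQ
  have hq := length_pos Q.freq
  have hl := Tile.freq_length Q
  refine ⟨⟨subset_rfl, ?_⟩, ?_⟩
  · intro y hy
    apply subset_convexHull
    right
    have e : 1 / (2 * Q.space.length) = Q.freq.length / 2 := by rw [hl]; field_simp
    simp only [e] at hy
    rw [mem_dilate, upper_center, upper_length]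
    constructor <;> linarith [hy.1, hy.2]
  · rw [mem_dilate, upper_center, upper_length]
    constructor <;> simp only <;> linarith

end

section

/-! ### Decay weights -/

/-- The weight `(1 + |x - c| / ℓ)^{-2}` adapted to an interval with center `c` and length `ℓ`. -/
def decay (c ℓ x : ℝ) : ℝ := ((1 + |x - c| / ℓ) ^ 2)⁻¹

section Decay

variable {c c' ℓ ℓ' x : ℝ}

lemma decay_pos (hl : 0 < ℓ) : 0 < decay c ℓ x := by unfold decay; positivity

lemma decay_le_one (hl : 0 < ℓ) : decay c ℓ x ≤ 1 := by
  unfold decay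
  have : 0 ≤ |x - c| / ℓ := by positivity
  exact inv_le_one_of_one_le₀ (one_le_pow₀ (by linarith))

lemma decay_comm : decay c ℓ x = decay x ℓ c := by unfold decay; rw [abs_sub_comm]

lemma decay_le_of_dist_le (hl : 0 < ℓ) {a y b : ℝ} (h : |x - a| ≤ |y - b|) :
    decay b ℓ y ≤ decay a ℓ x := by
  unfold decay; gcongr

lemma decay_mono_scale (hl : 0 < ℓ) (h : ℓ ≤ ℓ') : decay c ℓ x ≤ decay c ℓ' x := by
  have := hl.trans_le h
  unfold decay; gcongr

lemma decay_mul_le (hl : 0 < ℓ) : decay c ℓ x * decay c' ℓ x ≤ decay c ℓ c' := by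
  unfold decay
  rw [← mul_inv, ← mul_pow]
  have h : |c' - c| ≤ |x - c| + |x - c'| := by
    calc |c' - c| = |(x - c) - (x - c')| := by congr 1; ring
      _ ≤ _ := abs_sub _ _
  have h2 : |c' - c| / ℓ ≤ |x - c| / ℓ + |x - c'| / ℓ := by
    rw [← add_div]; gcongr
  have h3 : 0 ≤ |x - c| / ℓ := by positivity
  have h4 : 0 ≤ |x - c'| / ℓ := by positivity
  gcongr
  nlinarith

lemma decay_le_four_mul (hl : 0 < ℓ) (h : |x - c'| ≤ ℓ) : decay c ℓ c' ≤ 4 * decay c ℓ x := by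
  unfold decay
  have h1 : |x - c| ≤ |c' - c| + ℓ := by
    calc |x - c| = |(c' - c) + (x - c')| := by congr 1; ring
      _ ≤ |c' - c| + |x - c'| := abs_add_le _ _
      _ ≤ _ := by linarith
  have h2 : |x - c| / ℓ ≤ |c' - c| / ℓ + 1 := by
    rw [div_add_one hl.ne']; gcongr
  have h3 : 0 ≤ |c' - c| / ℓ := by positivity
  have h4 : 0 ≤ |x - c| / ℓ := by positivity
  rw [show (4 : ℝ) * ((1 + |x - c| / ℓ) ^ 2)⁻¹ = (((1 + |x - c| / ℓ) / 2) ^ 2)⁻¹ by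
    rw [div_pow, inv_div, ← div_eq_mul_inv]; norm_num]
  gcongr
  linarith

lemma decay_le_inv_one_add_sq (hl : 0 < ℓ) : decay c ℓ x ≤ (1 + ((x - c) / ℓ) ^ 2)⁻¹ := by
  unfold decay
  have h : 0 ≤ |x - c| / ℓ := by positivity
  have e : ((x - c) / ℓ) ^ 2 = (|x - c| / ℓ) ^ 2 := by rw [div_pow, div_pow, sq_abs]
  rw [e]
  gcongr
  nlinarith

lemma continuous_decay (hl : 0 < ℓ) : Continuous (decay c ℓ) := by
  unfold decay
  apply Continuous.inv₀ (by fun_prop)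
  intro x; positivity

lemma integrable_decay (hl : 0 < ℓ) : Integrable (decay c ℓ) := by
  have h : Integrable fun x : ℝ => (1 + ((x - c) / ℓ) ^ 2)⁻¹ :=
    (integrable_inv_one_add_sq.comp_div hl.ne').comp_sub_right c
  refine h.mono' (continuous_decay hl).aestronglyMeasurable (.of_forall fun x => ?_)
  rw [Real.norm_of_nonneg (decay_pos hl).le]
  exact decay_le_inv_one_add_sq hl

lemma integral_decay_le (hl : 0 < ℓ) : ∫ x, decay c ℓ x ≤ Real.pi * ℓ := by
  have h : Integrable fun x : ℝ => (1 + ((x - c) / ℓ) ^ 2)⁻¹ :=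
    (integrable_inv_one_add_sq.comp_div hl.ne').comp_sub_right c
  refine (integral_mono (integrable_decay hl) h fun x => decay_le_inv_one_add_sq hl).trans ?_
  rw [integral_sub_right_eq_self (fun x : ℝ => (1 + (x / ℓ) ^ 2)⁻¹) c,
    Measure.integral_comp_div (fun x : ℝ => (1 + x ^ 2)⁻¹) ℓ, integral_univ_inv_one_add_sq,
    abs_of_pos hl, smul_eq_mul, mul_comm]

end Decay

/-- Disjoint intervals of length at most `ℓ` have a bounded total mass, relative to `ℓ`, against
a weight of scale `ℓ`: the sum is a Riemann sum of the integral of the weight. -/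
lemma packing {D : Finset Tile} {c ℓ : ℝ} (hl : 0 < ℓ) (hle : ∀ P ∈ D, P.space.length ≤ ℓ)
    (hd : ∀ P ∈ D, ∀ Q ∈ D, P ≠ Q → Disjoint P.space.toSet Q.space.toSet) :
    ∑ P ∈ D, P.space.length * decay c ℓ P.space.center ≤ 4 * Real.pi * ℓ := by
  have hm : ∀ P : Tile, MeasurableSet P.space.toSet := fun P => measurableSet_Ico
  have hint := integrable_decay (c := c) hl
  calc ∑ P ∈ D, P.space.length * decay c ℓ P.space.center
      ≤ ∑ P ∈ D, ∫ x in P.space.toSet, 4 * decay c ℓ x := by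
        refine Finset.sum_le_sum fun P hP => ?_
        have hp := length_pos P.space
        have hv : (volume P.space.toSet) = ENNReal.ofReal P.space.length := by
          rw [DyadicInterval.toSet, Real.volume_Ico]; congr 1; ring
        calc P.space.length * decay c ℓ P.space.center
            = ∫ x in P.space.toSet, decay c ℓ P.space.center := by
              rw [setIntegral_const, measureReal_def, hv, ENNReal.toReal_ofReal hp.le, smul_eq_mul]
          _ ≤ _ := by
              refine setIntegral_mono_on ?_ (hint.const_mul 4).integrableOn (hm P) fun x hx => ?_
              · exact integrableOn_const (by rw [hv]; exact ENNReal.ofReal_ne_top)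
              · apply decay_le_four_mul hl
                rw [mem_toSet] at hx
                rw [abs_le]
                constructor <;> linarith [hx.1, hx.2, hle P hP]
    _ = ∫ x in ⋃ P ∈ D, P.space.toSet, 4 * decay c ℓ x := by
        rw [integral_biUnion_finset D (fun P _ => hm P) (fun P hP Q hQ h => hd P hP Q hQ h)
          (fun P _ => (hint.const_mul 4).integrableOn)]
    _ ≤ ∫ x, 4 * decay c ℓ x :=
        setIntegral_le_integral (hint.const_mul 4)
          (.of_forall fun x => mul_nonneg (by norm_num) (decay_pos hl).le)
    _ ≤ 4 * Real.pi * ℓ := by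
        rw [integral_const_mul, mul_assoc]
        exact mul_le_mul_of_nonneg_left (integral_decay_le hl) (by norm_num)

/-! ### Wave packets -/

/-- The properties of a single wave packet that enter the argument: continuity, decay of order
six away from `I_P`, and frequency support in `(5/4) ω_P`. -/
structure IsPacket (K : ℝ) (P : Tile) (ψ : ℝ → ℂ) : Prop where
  cont : Continuous ψ
  supp : ∀ ξ : ℝ, ξ ∉ P.freq.dilate (5 / 4) → angularFourier ψ ξ = 0
  bound : ∀ x, ‖ψ x‖ ≤ K / P.space.length * decay P.space.center P.space.length x ^ 3

lemma IsWavePackets.isPacket {A : ℕ → ℕ → ℝ} {T : Finset Tile} {φ : Tile → ℝ → ℂ}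
    (h : IsWavePackets A T φ) {P : Tile} (hP : P ∈ T) : IsPacket (A 0 6) P (φ P) where
  cont := (h.smooth P hP).continuous
  supp := h.freq_support P hP
  bound x := by
    have := h.bound P hP 0 6 x
    rw [iteratedDeriv_zero, norm_mul, Complex.norm_exp] at this
    simpa [decay, ← pow_mul] using this

variable {K : ℝ} {P Q : Tile} {ψ χ : ℝ → ℂ}

lemma IsPacket.nonneg (h : IsPacket K P ψ) : 0 ≤ K := by
  have h1 := (norm_nonneg _).trans (h.bound P.space.center)
  have hp := length_pos P.space
  have h2 : 0 < decay P.space.center P.space.length P.space.center := decay_pos hp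
  by_contra hK
  have : K / P.space.length < 0 := div_neg_of_neg_of_pos (not_le.1 hK) hp
  have := mul_neg_of_neg_of_pos this (pow_pos h2 3)
  linarith

lemma IsPacket.bound_one (h : IsPacket K P ψ) (x : ℝ) :
    ‖ψ x‖ ≤ K / P.space.length * decay P.space.center P.space.length x := by
  have hp := length_pos P.space
  have := h.nonneg
  refine (h.bound x).trans (mul_le_mul_of_nonneg_left ?_ (by positivity))
  exact pow_le_of_le_one (decay_pos hp).le (decay_le_one hp) (by norm_num)

lemma IsPacket.integrable (h : IsPacket K P ψ) : Integrable ψ :=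
  ((integrable_decay (length_pos P.space)).const_mul _).mono' h.cont.aestronglyMeasurable
    (.of_forall h.bound_one)

lemma IsPacket.memLp (h : IsPacket K P ψ) : MemLp ψ 2 := by
  rw [memLp_two_iff_integrable_sq_norm h.cont.aestronglyMeasurable]
  have hp := length_pos P.space
  have hK := h.nonneg
  refine (h.integrable.norm.const_mul (K / P.space.length)).mono'
    (h.cont.norm.pow 2).aestronglyMeasurable (.of_forall fun x => ?_)
  have h1 : ‖ψ x‖ ≤ K / P.space.length :=
    (h.bound_one x).trans (mul_le_of_le_one_right (by positivity) (decay_le_one hp))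
  rw [Real.norm_of_nonneg (by positivity), sq]
  exact mul_le_mul_of_nonneg_right h1 (norm_nonneg _)

lemma fourier_eq_angularFourier (ψ : ℝ → ℂ) (w : ℝ) :
    FourierTransform.fourier ψ w =
      (((2 * Real.pi) ^ (1 / 2 : ℝ) : ℝ) : ℂ) * angularFourier ψ (2 * Real.pi * w) := by
  have hpi := Real.pi_pos
  rw [angularFourier, ← mul_assoc, ← Complex.ofReal_mul, ← Real.rpow_add (by positivity),
    Real.fourier_real_eq_integral_exp_smul]
  norm_num
  congr 1
  ext x
  rw [mul_comm]
  congr 2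
  ring

/-- Two wave packets whose frequency supports are disjoint are orthogonal. -/
lemma IsPacket.orthogonal (hψ : IsPacket K P ψ) (hχ : IsPacket K Q χ)
    (h : ∀ ξ, ξ ∈ P.freq.dilate (5 / 4) → ξ ∉ Q.freq.dilate (5 / 4)) :
    ∫ x, χ x * (starRingEnd ℂ) (ψ x) = 0 := by
  have hpi := Real.pi_pos
  have hcont : Continuous (FourierTransform.fourier χ) :=
    VectorFourier.fourierIntegral_continuous Real.continuous_fourierChar
      (by exact continuous_inner) hχ.integrable
  have hsupp : HasCompactSupport (FourierTransform.fourier χ) := by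
    refine HasCompactSupport.intro (K := Set.Icc
      ((Q.freq.center - 5 / 4 / 2 * Q.freq.length) / (2 * Real.pi))
      ((Q.freq.center + 5 / 4 / 2 * Q.freq.length) / (2 * Real.pi))) isCompact_Icc fun w hw => ?_
    rw [fourier_eq_angularFourier, hχ.supp _ fun hm => hw ?_, mul_zero]
    rw [mem_dilate] at hm
    constructor
    · rw [div_le_iff₀ (by positivity)]; linarith [hm.1]
    · rw [le_div_iff₀ (by positivity)]; linarith [hm.2]
  have hint : Integrable (FourierTransform.fourier χ) := hcont.integrable_of_hasCompactSupport hsupp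
  have key := VectorFourier.integral_sesq_fourierIntegral_eq_neg_flip (innerSL ℂ)
    (L := innerₗ ℝ) Real.continuous_fourierChar continuous_inner hψ.integrable hint
  have e1 : VectorFourier.fourierIntegral Real.fourierChar volume (-(innerₗ ℝ).flip)
      (FourierTransform.fourier χ) = χ := by
    refine Eq.trans ?_ (hχ.cont.fourierInv_fourier_eq hχ.integrable hint)
    ext x
    simp [VectorFourier.fourierIntegral, Real.fourierInv_eq]
  rw [e1] at key
  calc ∫ x, χ x * (starRingEnd ℂ) (ψ x) = ∫ x, innerSL ℂ (ψ x) (χ x) := by simp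
    _ = ∫ w, innerSL ℂ (FourierTransform.fourier ψ w) (FourierTransform.fourier χ w) := key.symm
    _ = ∫ w : ℝ, (0 : ℂ) := by
      congr 1
      ext w
      rw [fourier_eq_angularFourier ψ, fourier_eq_angularFourier χ]
      by_cases hw : 2 * Real.pi * w ∈ P.freq.dilate (5 / 4)
      · rw [hχ.supp _ (h _ hw)]; simp
      · rw [hψ.supp _ hw]; simp
    _ = 0 := by simp

/-- The inner product of two wave packets is controlled by the larger one of the two scales. -/
lemma IsPacket.norm_integral_le (hψ : IsPacket K P ψ) (hχ : IsPacket K Q χ)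
    (h : Q.space.length ≤ P.space.length) :
    ‖∫ x, χ x * (starRingEnd ℂ) (ψ x)‖ ≤ Real.pi * K ^ 2 / P.space.length *
      decay P.space.center P.space.length Q.space.center ^ 2 := by
  have hp := length_pos P.space
  have hq := length_pos Q.space
  have hK := hψ.nonneg
  set d := decay P.space.center P.space.length Q.space.center
  have hd : 0 < d := decay_pos hp
  calc ‖∫ x, χ x * (starRingEnd ℂ) (ψ x)‖
      ≤ ∫ x, K ^ 2 / (P.space.length * Q.space.length) * d ^ 2 *
          decay Q.space.center Q.space.length x := by
        refine norm_integral_le_of_norm_le ((integrable_decay hq).const_mul _)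
          (.of_forall fun x => ?_)
        have h1 := hψ.bound x
        have h2 := hχ.bound x
        rw [norm_mul, RCLike.norm_conj]
        set u := decay P.space.center P.space.length x
        set v := decay Q.space.center Q.space.length x
        have hu : 0 < u := decay_pos hp
        have hv : 0 < v := decay_pos hq
        have hu1 : u ≤ 1 := decay_le_one hp
        have huv : u * v ≤ d :=
          (mul_le_mul_of_nonneg_left (decay_mono_scale hq h) hu.le).trans (decay_mul_le hp)
        calc ‖χ x‖ * ‖ψ x‖ ≤ (K / Q.space.length * v ^ 3) * (K / P.space.length * u ^ 3) := by
              gcongr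
          _ = K ^ 2 / (P.space.length * Q.space.length) * (u * v) ^ 2 * v * u := by
              field_simp
          _ ≤ K ^ 2 / (P.space.length * Q.space.length) * d ^ 2 * v * 1 := by gcongr
          _ = _ := mul_one _
    _ ≤ K ^ 2 / (P.space.length * Q.space.length) * d ^ 2 * (Real.pi * Q.space.length) := by
        rw [integral_const_mul]
        exact mul_le_mul_of_nonneg_left (integral_decay_le hq) (by positivity)
    _ = _ := by field_simp

/-! ### The `T T^*` argument -/

open scoped InnerProductSpace in
/-- The `T T^*` inequality for a finite family of vectors `v` in a Hilbert space. -/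
lemma sq_sum_inner_le {H ι : Type*} [NormedAddCommGroup H] [InnerProductSpace ℂ H]
    (D : Finset ι) (v : ι → H) (w : ι → ℝ) (hw : ∀ i ∈ D, 0 ≤ w i) (f : H) :
    (∑ i ∈ D, ‖⟪v i, f⟫_ℂ‖ ^ 2 * w i) ^ 2 ≤ ‖f‖ ^ 2 *
      ∑ i ∈ D, ∑ j ∈ D, (‖⟪v i, f⟫_ℂ‖ * w i) * (‖⟪v j, f⟫_ℂ‖ * w j) * ‖⟪v i, v j⟫_ℂ‖ := by
  set h : H := ∑ i ∈ D, ((w i : ℂ) * ⟪v i, f⟫_ℂ) • v i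
  have h1 : ⟪f, h⟫_ℂ = ((∑ i ∈ D, ‖⟪v i, f⟫_ℂ‖ ^ 2 * w i : ℝ) : ℂ) := by
    simp only [h, inner_sum, inner_smul_right]
    push_cast
    refine Finset.sum_congr rfl fun i _ => ?_
    rw [← inner_conj_symm f (v i), mul_assoc, Complex.mul_conj, Complex.normSq_eq_norm_sq]
    push_cast; ring
  have h0 : 0 ≤ ∑ i ∈ D, ‖⟪v i, f⟫_ℂ‖ ^ 2 * w i :=
    Finset.sum_nonneg fun i hi => mul_nonneg (by positivity) (hw i hi)
  have h2 : ∑ i ∈ D, ‖⟪v i, f⟫_ℂ‖ ^ 2 * w i ≤ ‖f‖ * ‖h‖ := by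
    have := norm_inner_le_norm (𝕜 := ℂ) f h
    rwa [h1, Complex.norm_real, Real.norm_of_nonneg h0] at this
  have h3 : ‖h‖ ^ 2 ≤
      ∑ i ∈ D, ∑ j ∈ D, (‖⟪v i, f⟫_ℂ‖ * w i) * (‖⟪v j, f⟫_ℂ‖ * w j) * ‖⟪v i, v j⟫_ℂ‖ := by
    have e : ‖h‖ ^ 2 = ‖⟪h, h⟫_ℂ‖ := by
      rw [inner_self_eq_norm_sq_to_K]; simp
    rw [e]
    simp only [h, sum_inner, inner_sum, inner_smul_left, inner_smul_right,
      Finset.mul_sum]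
    apply (norm_sum_le _ _).trans
    refine Finset.sum_le_sum fun i hi => ?_
    apply (norm_sum_le _ _).trans
    refine Finset.sum_le_sum fun j hj => le_of_eq ?_
    simp only [norm_mul, RCLike.norm_conj, Complex.norm_real, norm_inner_symm (v j) (v i),
      Real.norm_of_nonneg (hw i hi), Real.norm_of_nonneg (hw j hj)]
    ring
  calc _ ≤ (‖f‖ * ‖h‖) ^ 2 := by gcongr
    _ = ‖f‖ ^ 2 * ‖h‖ ^ 2 := mul_pow _ _ _
    _ ≤ _ := by gcongr

lemma inner_toLp {f g : ℝ → ℂ} (hf : MemLp f 2) (hg : MemLp g 2) :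
    inner ℂ (hg.toLp g) (hf.toLp f) = ∫ x, f x * (starRingEnd ℂ) (g x) := by
  rw [L2.inner_def]
  apply integral_congr_ae
  filter_upwards [hf.coeFn_toLp, hg.coeFn_toLp] with x h1 h2
  rw [h1, h2]
  simp

end

section

/-! ### Bessel inequalities for families of wave packets -/

/-- The coefficient `⟨f, φ_P⟩`. -/
def coeff (φ : Tile → ℝ → ℂ) (f : ℝ → ℂ) (P : Tile) : ℂ :=
  ∫ x, f x * (starRingEnd ℂ) (φ P x)

/-- The weighted square sum `∑_{P ∈ D} |⟨f, φ_P⟩|² |I_P|`. -/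
def energy (φ : Tile → ℝ → ℂ) (f : ℝ → ℂ) (D : Finset Tile) : ℝ :=
  ∑ P ∈ D, ‖coeff φ f P‖ ^ 2 * P.space.length

lemma energy_nonneg (φ : Tile → ℝ → ℂ) (f : ℝ → ℂ) (D : Finset Tile) : 0 ≤ energy φ f D :=
  Finset.sum_nonneg fun P _ => mul_nonneg (by positivity) (length_pos P.space).le

variable {C₀ K : ℝ} {T D : Finset Tile} {φ : Tile → ℝ → ℂ} {f : ℝ → ℂ} {n : ℤ}

lemma norm_coeff_symm (hφ : ∀ P ∈ T, IsPacket K P (φ P)) {P Q : Tile} (hP : P ∈ T)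
    (hQ : Q ∈ T) : ‖coeff φ (φ Q) P‖ = ‖coeff φ (φ P) Q‖ := by
  unfold coeff
  rw [← inner_toLp (hφ Q hQ).memLp (hφ P hP).memLp, ← inner_toLp (hφ P hP).memLp (hφ Q hQ).memLp,
    norm_inner_symm]

lemma norm_toLp_sq (hf : MemLp f 2) : ‖hf.toLp f‖ ^ 2 = ∫ x, ‖f x‖ ^ 2 := by
  have h := inner_toLp hf hf
  rw [inner_self_eq_norm_sq_to_K] at h
  have e : ∀ x, f x * (starRingEnd ℂ) (f x) = ((‖f x‖ ^ 2 : ℝ) : ℂ) := fun x => by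
    rw [Complex.mul_conj, Complex.normSq_eq_norm_sq]
  simp only [e] at h
  rw [integral_complex_ofReal] at h
  apply Complex.ofReal_injective
  rw [← h]
  simp

/-- Interaction of a wave packet with the wave packets of the same scale. -/
lemma sum_same_scale_le (hC : 2 ≤ C₀) (hT : IsSparse C₀ T)
    (hφ : ∀ P ∈ T, IsPacket K P (φ P)) (hD : D ⊆ T) {P : Tile} (hP : P ∈ D) :
    (∑ Q ∈ D, if Q.space.length = P.space.length then Q.space.length * ‖coeff φ (φ Q) P‖ else 0) ≤
      4 * Real.pi ^ 2 * K ^ 2 := by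
  classical
  have hp := length_pos P.space
  calc _ ≤ ∑ Q ∈ D, if Q.space.length = P.space.length ∧ Q.freq = P.freq then
          Real.pi * K ^ 2 / P.space.length *
            (Q.space.length * decay P.space.center P.space.length Q.space.center) else 0 := by
        refine Finset.sum_le_sum fun Q hQ => ?_
        by_cases h1 : Q.space.length = P.space.length
        · rw [if_pos h1]
          by_cases h2 : Q.freq = P.freq
          · rw [if_pos ⟨h1, h2⟩]
            have := (hφ P (hD hP)).norm_integral_le (hφ Q (hD hQ)) h1.le
            have hd : 0 < decay P.space.center P.space.length Q.space.center := decay_pos hp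
            have hd1 : decay P.space.center P.space.length Q.space.center ≤ 1 := decay_le_one hp
            have hq := length_pos Q.space
            have hpi := Real.pi_pos
            calc Q.space.length * ‖coeff φ (φ Q) P‖
                ≤ Q.space.length * (Real.pi * K ^ 2 / P.space.length *
                  decay P.space.center P.space.length Q.space.center ^ 2) := by
                  gcongr; exact this
              _ ≤ Q.space.length * (Real.pi * K ^ 2 / P.space.length *
                  decay P.space.center P.space.length Q.space.center) := by
                  gcongr; exact pow_le_of_le_one hd.le hd1 (by norm_num)
              _ = _ := by ring
          · rw [if_neg (fun h => h2 h.2)]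
            have h0 : coeff φ (φ Q) P = 0 := by
              refine (hφ P (hD hP)).orthogonal (hφ Q (hD hQ)) fun ξ hξP hξQ => h2 ?_
              exact (freq_eq_of_inter (by linarith) hT (hD hP) (hD hQ) h1
                (dilate_mono _ (by linarith) hξP) (dilate_mono _ (by linarith) hξQ)).symm
            rw [h0]; simp
        · rw [if_neg h1, if_neg (fun h => h1 h.1)]
    _ = Real.pi * K ^ 2 / P.space.length *
          ∑ Q ∈ D with Q.space.length = P.space.length ∧ Q.freq = P.freq,
            Q.space.length * decay P.space.center P.space.length Q.space.center := by
        rw [Finset.mul_sum, Finset.sum_filter]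
    _ ≤ Real.pi * K ^ 2 / P.space.length * (4 * Real.pi * P.space.length) := by
        have hpi := Real.pi_pos
        refine mul_le_mul_of_nonneg_left (packing hp ?_ ?_) (by positivity)
        · intro Q hQ
          exact (Finset.mem_filter.1 hQ).2.1.le
        · intro Q hQ R hR hne
          exact disjoint_of_freq_eq hne
            ((Finset.mem_filter.1 hQ).2.2.trans (Finset.mem_filter.1 hR).2.2.symm)
    _ = _ := by field_simp

/-- The part of the quadratic form of the Gram matrix that comes from pairs of tiles of different
scales. -/
def crossTerms (φ : Tile → ℝ → ℂ) (f : ℝ → ℂ) (D : Finset Tile) : ℝ :=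
  ∑ P ∈ D, ∑ Q ∈ D, if Q.space.length < P.space.length then
    (‖coeff φ f P‖ * P.space.length) * (‖coeff φ f Q‖ * Q.space.length) * ‖coeff φ (φ Q) P‖ else 0

/-- The Bessel inequality, up to the contribution of pairs of tiles of different scales. -/
lemma energy_sq_le (hC : 2 ≤ C₀) (hT : IsSparse C₀ T)
    (hφ : ∀ P ∈ T, IsPacket K P (φ P)) (hD : D ⊆ T) (hf : MemLp f 2) :
    energy φ f D ^ 2 ≤
      (∫ x, ‖f x‖ ^ 2) * (4 * Real.pi ^ 2 * K ^ 2 * energy φ f D + 2 * crossTerms φ f D) := by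
  classical
  set v : Tile → Lp ℂ 2 (volume : Measure ℝ) :=
    fun P => if h : P ∈ T then (hφ P h).memLp.toLp (φ P) else 0
  have hv : ∀ P ∈ D, ∀ g : ℝ → ℂ, ∀ hg : MemLp g 2, inner ℂ (v P) (hg.toLp g) = coeff φ g P := by
    intro P hP g hg
    simp only [v, dif_pos (hD hP)]
    exact inner_toLp hg _
  have hvv : ∀ P ∈ D, ∀ Q ∈ D, inner ℂ (v P) (v Q) = coeff φ (φ Q) P := by
    intro P hP Q hQ
    rw [← hv P hP (φ Q) (hφ Q (hD hQ)).memLp]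
    simp only [v, dif_pos (hD hQ)]
  have key := sq_sum_inner_le D v (fun P => P.space.length) (fun P _ => (length_pos _).le)
    (hf.toLp f)
  rw [norm_toLp_sq] at key
  set H : Tile → Tile → ℝ := fun P Q =>
    (‖coeff φ f P‖ * P.space.length) * (‖coeff φ f Q‖ * Q.space.length) * ‖coeff φ (φ Q) P‖
  have hHsymm : ∀ P ∈ D, ∀ Q ∈ D, H P Q = H Q P := by
    intro P hP Q hQ
    simp only [H, norm_coeff_symm hφ (hD hP) (hD hQ)]
    ring
  have e1 : ∑ P ∈ D, ‖inner ℂ (v P) (hf.toLp f)‖ ^ 2 * P.space.length = energy φ f D :=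
    Finset.sum_congr rfl fun P hP => by rw [hv P hP]
  have e2 : ∑ P ∈ D, ∑ Q ∈ D, (‖inner ℂ (v P) (hf.toLp f)‖ * P.space.length) *
      (‖inner ℂ (v Q) (hf.toLp f)‖ * Q.space.length) * ‖inner ℂ (v P) (v Q)‖ =
      ∑ P ∈ D, ∑ Q ∈ D, H P Q :=
    Finset.sum_congr rfl fun P hP => Finset.sum_congr rfl fun Q hQ => by
      rw [hv P hP, hv Q hQ, hvv P hP Q hQ]
  rw [e1, e2] at key
  refine key.trans (mul_le_mul_of_nonneg_left ?_ (integral_nonneg fun x => by positivity))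
  have split : ∑ P ∈ D, ∑ Q ∈ D, H P Q =
      (∑ P ∈ D, ∑ Q ∈ D, if Q.space.length = P.space.length then H P Q else 0) +
      crossTerms φ f D + ∑ P ∈ D, ∑ Q ∈ D, if P.space.length < Q.space.length then H P Q else 0 := by
    rw [crossTerms, ← Finset.sum_add_distrib, ← Finset.sum_add_distrib]
    refine Finset.sum_congr rfl fun P _ => ?_
    rw [← Finset.sum_add_distrib, ← Finset.sum_add_distrib]
    refine Finset.sum_congr rfl fun Q _ => ?_
    rcases lt_trichotomy Q.space.length P.space.length with h | h | h
    · rw [if_neg h.ne, if_pos h, if_neg h.not_gt]; simp [H]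
    · rw [if_pos h, if_neg (by simp [h]), if_neg (by simp [h])]; simp
    · rw [if_neg h.ne', if_neg h.not_gt, if_pos h]; simp
  have third : (∑ P ∈ D, ∑ Q ∈ D, if P.space.length < Q.space.length then H P Q else 0) =
      crossTerms φ f D := by
    rw [Finset.sum_comm, crossTerms]
    refine Finset.sum_congr rfl fun P hP => Finset.sum_congr rfl fun Q hQ => ?_
    rw [hHsymm Q hQ P hP]
  -- The diagonal part, by `2 a b ≤ a² + b²` and Schur's test.
  set L : Tile → Tile → ℝ := fun P Q => if Q.space.length = P.space.length then
    (‖coeff φ f P‖ ^ 2 * P.space.length) * (Q.space.length * ‖coeff φ (φ Q) P‖) else 0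
  have diag : (∑ P ∈ D, ∑ Q ∈ D, if Q.space.length = P.space.length then H P Q else 0) ≤
      ∑ P ∈ D, ∑ Q ∈ D, L P Q := by
    have hsymm : ∑ P ∈ D, ∑ Q ∈ D, L P Q = ∑ P ∈ D, ∑ Q ∈ D, (L P Q + L Q P) / 2 := by
      simp only [add_div, Finset.sum_add_distrib]
      rw [Finset.sum_comm (f := fun P Q => L Q P / 2)]
      simp only [← Finset.sum_div]
      ring
    rw [hsymm]
    refine Finset.sum_le_sum fun P hP => Finset.sum_le_sum fun Q hQ => ?_
    by_cases h : Q.space.length = P.space.length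
    · simp only [L, H, if_pos h, if_pos h.symm]
      rw [norm_coeff_symm hφ (hD hQ) (hD hP)]
      have hp := length_pos P.space
      have hq := length_pos Q.space
      have := mul_nonneg (sq_nonneg (‖coeff φ f P‖ - ‖coeff φ f Q‖))
        (mul_nonneg (mul_nonneg hp.le hq.le) (norm_nonneg (coeff φ (φ Q) P)))
      nlinarith
    · simp [L, if_neg h, if_neg (Ne.symm h)]
  have schur : ∑ P ∈ D, ∑ Q ∈ D, L P Q ≤ 4 * Real.pi ^ 2 * K ^ 2 * energy φ f D := by
    rw [energy, Finset.mul_sum]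
    refine Finset.sum_le_sum fun P hP => ?_
    calc ∑ Q ∈ D, L P Q = (‖coeff φ f P‖ ^ 2 * P.space.length) * ∑ Q ∈ D,
          (if Q.space.length = P.space.length then Q.space.length * ‖coeff φ (φ Q) P‖ else 0) := by
          rw [Finset.mul_sum]
          refine Finset.sum_congr rfl fun Q _ => ?_
          simp only [L, mul_ite, mul_zero]
      _ ≤ (‖coeff φ f P‖ ^ 2 * P.space.length) * (4 * Real.pi ^ 2 * K ^ 2) :=
          mul_le_mul_of_nonneg_left (sum_same_scale_le hC hT hφ hD hP)
            (mul_nonneg (by positivity) (length_pos _).le)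
      _ = _ := by ring
  rw [split, third]
  linarith

/-- The Bessel inequality for a tree: its wave packets of different scales are orthogonal. -/
lemma Tree.Lac.energy_le (hn : (501 : ℝ) ≤ n) (hC : (n : ℝ) + 100 ≤ C₀) (hT : IsSparse C₀ T)
    (hφ : ∀ P ∈ T, IsPacket K P (φ P)) {t : Tree} (ht : t.Lac n) (htT : t.tiles ⊆ T)
    (hf : MemLp f 2) :
    energy φ f t.tiles ≤ 4 * Real.pi ^ 2 * K ^ 2 * ∫ x, ‖f x‖ ^ 2 := by
  have h0 : crossTerms φ f t.tiles = 0 := by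
    refine Finset.sum_eq_zero fun P hP => Finset.sum_eq_zero fun Q hQ => ?_
    split_ifs with h
    · have : coeff φ (φ Q) P = 0 :=
        (hφ P (htT hP)).orthogonal (hφ Q (htT hQ)) fun ξ h1 h2 =>
          ht.not_meet hn hC hT htT hP hQ h (dilate_mono _ (by norm_num) h1)
            (dilate_mono _ (by norm_num) h2)
      simp [this]
    · rfl
  have key := energy_sq_le (by linarith) hT hφ htT hf
  rw [h0, mul_zero, add_zero] at key
  have h1 := energy_nonneg φ f t.tiles
  rcases h1.eq_or_lt with h | h
  · rw [← h]
    have : 0 ≤ ∫ x, ‖f x‖ ^ 2 := integral_nonneg fun x => by positivity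
    positivity
  · refine le_of_mul_le_mul_right ?_ h
    nlinarith

/-! ### The estimate for bounded functions -/

lemma sum_two_zpow_le {U : Finset ℤ} {m : ℤ} (h : ∀ k ∈ U, k ≤ m) :
    ∑ k ∈ U, (2 : ℝ) ^ k ≤ 2 * 2 ^ m := by
  have hinj : Set.InjOn (fun k : ℤ => (m - k).toNat) U := by
    intro a ha b hb hab
    have := h a ha
    have := h b hb
    simp only at hab
    omega
  calc ∑ k ∈ U, (2 : ℝ) ^ k = ∑ k ∈ U, 2 ^ m * (1 / 2 : ℝ) ^ (m - k).toNat := by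
        refine Finset.sum_congr rfl fun k hk => ?_
        have hk' := h k hk
        rw [one_div, inv_pow, ← zpow_natCast, Int.toNat_of_nonneg (by omega), ← zpow_neg,
          ← zpow_add₀ (by norm_num)]
        congr 1; ring
    _ = 2 ^ m * ∑ j ∈ U.image (fun k : ℤ => (m - k).toNat), (1 / 2 : ℝ) ^ j := by
        rw [← Finset.mul_sum, Finset.sum_image hinj]
    _ ≤ 2 ^ m * 2 := by
        gcongr
        exact (summable_geometric_two.sum_le_tsum _ fun _ _ => by positivity).trans
          tsum_geometric_two.le
    _ = _ := mul_comm _ _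

/-- A sum over tiles that is `O(2^k)` on the tiles of scale `k` is dominated by its largest
scale. -/
lemma sum_le_of_scales {I : DyadicInterval} {h : Tile → ℝ} {B : ℝ} (hB : 0 ≤ B)
    (hD : ∀ P ∈ D, P.space.length ≤ I.length)
    (hs : ∀ R ∈ D, ∑ P ∈ D with P.space.scale = R.space.scale, h P ≤ B * R.space.length) :
    ∑ P ∈ D, h P ≤ 2 * B * I.length := by
  classical
  rw [← Finset.sum_fiberwise_of_maps_to (t := D.image fun P => P.space.scale)
    (g := fun P => P.space.scale) (fun P hP => Finset.mem_image_of_mem _ hP)]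
  calc _ ≤ ∑ k ∈ D.image fun P => P.space.scale, B * 2 ^ k := by
        refine Finset.sum_le_sum fun k hk => ?_
        obtain ⟨R, hR, rfl⟩ := Finset.mem_image.1 hk
        exact hs R hR
    _ ≤ B * (2 * 2 ^ I.scale) := by
        rw [← Finset.mul_sum]
        refine mul_le_mul_of_nonneg_left (sum_two_zpow_le fun k hk => ?_) hB
        obtain ⟨R, hR, rfl⟩ := Finset.mem_image.1 hk
        exact (zpow_le_zpow_iff_right₀ (by norm_num : (1 : ℝ) < 2)).1 (hD R hR)
    _ = _ := by rw [DyadicInterval.length]; ring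

lemma center_mem_of_subset {I J : DyadicInterval} (h : I.toSet ⊆ J.toSet) :
    J.center - J.length / 2 ≤ I.center ∧ I.center < J.center + J.length / 2 :=
  mem_toSet.1 (h (center_mem I))

/-- The tiles of one scale in a tree have total length at most a multiple of that of the top. -/
lemma Tree.Lac.sum_length_le (hn : (501 : ℝ) ≤ n) (hC : (n : ℝ) + 100 ≤ C₀) (hT : IsSparse C₀ T)
    {t : Tree} (ht : t.Lac n) (htT : t.tiles ⊆ T) (k : ℤ) :
    ∑ P ∈ t.tiles with P.space.scale = k, P.space.length ≤ 16 * Real.pi * t.top.length := by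
  have hl := length_pos t.top
  have h1 : ∑ P ∈ t.tiles with P.space.scale = k,
      P.space.length * decay t.top.center t.top.length P.space.center ≤
      4 * Real.pi * t.top.length := by
    refine packing hl (fun P hP => ht.length_le (Finset.mem_filter.1 hP).1) ?_
    intro P hP Q hQ hne
    rw [Finset.mem_filter] at hP hQ
    refine ht.disjoint hn hC hT htT hP.1 hQ.1 ?_ hne
    rw [DyadicInterval.length, DyadicInterval.length, hP.2, hQ.2]
  calc _ ≤ ∑ P ∈ t.tiles with P.space.scale = k,
      4 * (P.space.length * decay t.top.center t.top.length P.space.center) := by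
        refine Finset.sum_le_sum fun P hP => ?_
        have hc := center_mem_of_subset (ht P (Finset.mem_filter.1 hP).1).1.1
        have h2 := decay_le_four_mul (c := t.top.center) (c' := t.top.center)
          (x := P.space.center) hl (by rw [abs_le]; constructor <;> linarith [hc.1, hc.2])
        have h3 : decay t.top.center t.top.length t.top.center = 1 := by simp [decay]
        rw [h3] at h2
        have := mul_le_mul_of_nonneg_left h2 (length_pos P.space).le
        linarith
    _ ≤ _ := by rw [← Finset.mul_sum]; linarith

/-- A bounded function supported away from the top interval of a tree has rapidly decaying
coefficients on the tree. -/
lemma norm_coeff_far_le {P : Tile} {I : DyadicInterval} (h : IsPacket K P (φ P))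
    (hI : P.space.toSet ⊆ I.toSet) {M : ℝ} (hM : 0 ≤ M) (hf : ∀ᵐ x, ‖f x‖ ≤ M)
    (hsupp : ∀ x, |x - I.center| < 3 / 2 * I.length → f x = 0) :
    ‖coeff φ f P‖ ≤ Real.pi * M * K * (P.space.length / I.length) ^ 2 := by
  have hp := length_pos P.space
  have hl := length_pos I
  have hK := h.nonneg
  have hc := center_mem_of_subset hI
  calc ‖coeff φ f P‖ ≤ ∫ x, M * (K / P.space.length) * (P.space.length / I.length) ^ 2 *
        decay P.space.center P.space.length x := by
        refine norm_integral_le_of_norm_le ((integrable_decay hp).const_mul _) ?_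
        filter_upwards [hf] with x hx
        have hd : 0 < decay P.space.center P.space.length x := decay_pos hp
        by_cases hxI : |x - I.center| < 3 / 2 * I.length
        · rw [hsupp x hxI]; simp only [zero_mul, norm_zero]; positivity
        have hfar : I.length ≤ |x - P.space.center| := by
          rcases le_abs.1 (not_lt.1 hxI) with h1 | h1
          · exact le_abs.2 (Or.inl (by linarith [hc.2]))
          · exact le_abs.2 (Or.inr (by linarith [hc.1]))
        have hdl : decay P.space.center P.space.length x ≤ (P.space.length / I.length) ^ 2 := by
          rw [decay, ← inv_div I.length, inv_pow]
          gcongr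
          have : I.length / P.space.length ≤ |x - P.space.center| / P.space.length := by gcongr
          linarith
        have hd1 : decay P.space.center P.space.length x ≤ 1 := decay_le_one hp
        rw [norm_mul, RCLike.norm_conj]
        set u := decay P.space.center P.space.length x
        calc ‖f x‖ * ‖φ P x‖ ≤ M * (K / P.space.length * u ^ 3) := by
              gcongr; exact h.bound x
          _ = M * (K / P.space.length) * u * u * u := by ring
          _ ≤ M * (K / P.space.length) * (P.space.length / I.length) ^ 2 * u * 1 := by gcongr
          _ = _ := mul_one _
    _ ≤ M * (K / P.space.length) * (P.space.length / I.length) ^ 2 *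
        (Real.pi * P.space.length) := by
        rw [integral_const_mul]
        exact mul_le_mul_of_nonneg_left (integral_decay_le hp) (by positivity)
    _ = _ := by field_simp

lemma energy_add_le {g : ℝ → ℂ} (hadd : ∀ P ∈ D, coeff φ f P + coeff φ g P = coeff φ (f + g) P) :
    energy φ (f + g) D ≤ 2 * energy φ f D + 2 * energy φ g D := by
  simp only [energy, Finset.mul_sum, ← Finset.sum_add_distrib]
  refine Finset.sum_le_sum fun P hP => ?_
  rw [← hadd P hP]
  have h := norm_add_le (coeff φ f P) (coeff φ g P)
  have h1 : ‖coeff φ f P + coeff φ g P‖ ^ 2 ≤ 2 * ‖coeff φ f P‖ ^ 2 + 2 * ‖coeff φ g P‖ ^ 2 := by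
    nlinarith [sq_nonneg (‖coeff φ f P‖ - ‖coeff φ g P‖), norm_nonneg (coeff φ f P + coeff φ g P)]
  nlinarith [length_pos P.space]

lemma coeff_add {g : ℝ → ℂ} {P : Tile} (hf : Integrable fun x => f x * (starRingEnd ℂ) (φ P x))
    (hg : Integrable fun x => g x * (starRingEnd ℂ) (φ P x)) :
    coeff φ f P + coeff φ g P = coeff φ (f + g) P := by
  rw [coeff, coeff, coeff, ← integral_add hf hg]
  simp [add_mul]

lemma IsPacket.integrable_mul_of_two {P : Tile} (h : IsPacket K P (φ P)) (hf : MemLp f 2) :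
    Integrable fun x => f x * (starRingEnd ℂ) (φ P x) := by
  have : MemLp (fun x => (starRingEnd ℂ) (φ P x)) 2 := h.memLp.star
  exact hf.integrable_mul this

lemma IsPacket.integrable_mul_of_bound {P : Tile} (h : IsPacket K P (φ P)) {M : ℝ}
    (hm : AEStronglyMeasurable f) (hf : ∀ᵐ x, ‖f x‖ ≤ M) :
    Integrable fun x => f x * (starRingEnd ℂ) (φ P x) := by
  have : Integrable (fun x => (starRingEnd ℂ) (φ P x)) :=
    h.integrable.mono (Complex.continuous_conj.comp h.cont).aestronglyMeasurable
      (.of_forall fun x => by simp)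
  exact this.bdd_mul hm hf

/-- The constant of the estimate for bounded functions, per wave packet constant. -/
def bddConst : ℝ := 24 * Real.pi ^ 2 + 64 * Real.pi ^ 3

/-- The tree estimate for a bounded function: near the top interval by the Bessel inequality, away
from it by the decay of the wave packets. -/
lemma Tree.Lac.energy_le_of_bound (hn : (501 : ℝ) ≤ n) (hC : (n : ℝ) + 100 ≤ C₀)
    (hT : IsSparse C₀ T) (hφ : ∀ P ∈ T, IsPacket K P (φ P)) {t : Tree} (ht : t.Lac n)
    (htT : t.tiles ⊆ T) {M : ℝ} (hM : 0 ≤ M) (hm : AEStronglyMeasurable f)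
    (hf : ∀ᵐ x, ‖f x‖ ≤ M) :
    energy φ f t.tiles ≤ bddConst * K ^ 2 * M ^ 2 * t.top.length := by
  have hl := length_pos t.top
  have hpi := Real.pi_pos
  set J : Set ℝ := {x | |x - t.top.center| < 3 / 2 * t.top.length}
  have hJ : J = Metric.ball t.top.center (3 / 2 * t.top.length) := by
    ext x; simp [J, Real.dist_eq]
  have hJm : MeasurableSet J := by rw [hJ]; exact measurableSet_ball
  have hJv : volume J = ENNReal.ofReal (3 * t.top.length) := by
    rw [hJ, Real.volume_ball]; congr 1; ring
  have hb1 : ∀ᵐ x, ‖J.indicator f x‖ ≤ M := hf.mono fun x hx => by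
    by_cases h : x ∈ J <;> simp [h, hx, hM]
  have hb2 : ∀ᵐ x, ‖Jᶜ.indicator f x‖ ≤ M := hf.mono fun x hx => by
    by_cases h : x ∈ J <;> simp [h, hx, hM]
  have hm1 : AEStronglyMeasurable (J.indicator f) := hm.indicator hJm
  have hm2 : AEStronglyMeasurable (Jᶜ.indicator f) := hm.indicator hJm.compl
  have hsqI : Integrable (J.indicator fun _ => M ^ 2) := by
    rw [integrable_indicator_iff hJm]
    exact integrableOn_const (by rw [hJv]; exact ENNReal.ofReal_ne_top)
  have hsq : ∀ᵐ x, ‖J.indicator f x‖ ^ 2 ≤ J.indicator (fun _ => M ^ 2) x :=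
    hf.mono fun x hx => by
      by_cases h : x ∈ J
      · simp only [h, Set.indicator_of_mem]; gcongr
      · simp [h]
  have h2 : MemLp (J.indicator f) 2 := by
    rw [memLp_two_iff_integrable_sq_norm hm1]
    refine hsqI.mono' (hm1.norm.pow 2) (hsq.mono fun x hx => ?_)
    rwa [Real.norm_of_nonneg (by positivity)]
  have hN : ∫ x, ‖J.indicator f x‖ ^ 2 ≤ M ^ 2 * (3 * t.top.length) := by
    calc _ ≤ ∫ x, J.indicator (fun _ => M ^ 2) x :=
          integral_mono_of_nonneg (.of_forall fun x => by positivity) hsqI hsq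
      _ = _ := by
          rw [integral_indicator hJm, setIntegral_const, measureReal_def, hJv,
            ENNReal.toReal_ofReal (by positivity), smul_eq_mul, mul_comm]
  have hnear := ht.energy_le hn hC hT hφ htT h2
  have hfar : energy φ (Jᶜ.indicator f) t.tiles ≤
      2 * (16 * Real.pi * (Real.pi * M * K) ^ 2) * t.top.length := by
    refine sum_le_of_scales (I := t.top) (by positivity) (fun P hP => ht.length_le hP) ?_
    intro R hR
    have hr := length_pos R.space
    calc _ ≤ ∑ P ∈ t.tiles with P.space.scale = R.space.scale,
          (Real.pi * M * K) ^ 2 * (R.space.length / t.top.length) * P.space.length := by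
          refine Finset.sum_le_sum fun P hP => ?_
          rw [Finset.mem_filter] at hP
          have hPR : P.space.length = R.space.length := by
            rw [DyadicInterval.length, DyadicInterval.length, hP.2]
          have h1 := norm_coeff_far_le (f := Jᶜ.indicator f) (hφ P (htT hP.1)) (ht P hP.1).1.1 hM
            hb2 (fun x hx => by
              have : x ∈ J := hx
              simp [this])
          rw [hPR] at h1 ⊢
          have hq : R.space.length / t.top.length ≤ 1 :=
            (div_le_one hl).2 (hPR ▸ ht.length_le hP.1)
          have hq0 : 0 ≤ R.space.length / t.top.length := by positivity
          refine mul_le_mul_of_nonneg_right ?_ hr.le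
          calc _ ≤ (Real.pi * M * K * (R.space.length / t.top.length) ^ 2) ^ 2 := by gcongr
            _ = (Real.pi * M * K) ^ 2 * (R.space.length / t.top.length) ^ 4 := by ring
            _ ≤ _ := by gcongr; exact pow_le_of_le_one hq0 hq (by norm_num)
      _ ≤ (Real.pi * M * K) ^ 2 * (R.space.length / t.top.length) *
          (16 * Real.pi * t.top.length) := by
          rw [← Finset.mul_sum]
          exact mul_le_mul_of_nonneg_left (ht.sum_length_le hn hC hT htT _) (by positivity)
      _ = _ := by field_simp
  have hsum : J.indicator f + Jᶜ.indicator f = f := Set.indicator_self_add_compl J f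
  have := energy_add_le (φ := φ) (D := t.tiles) (f := J.indicator f) (g := Jᶜ.indicator f)
    fun P hP => coeff_add ((hφ P (htT hP)).integrable_mul_of_bound hm1 hb1)
      ((hφ P (htT hP)).integrable_mul_of_bound hm2 hb2)
  rw [hsum] at this
  have h3 := mul_le_mul_of_nonneg_left hN (show 0 ≤ 4 * Real.pi ^ 2 * K ^ 2 by positivity)
  unfold bddConst
  nlinarith

end

section

variable {C₀ K : ℝ} {T D : Finset Tile} {φ : Tile → ℝ → ℂ} {f : ℝ → ℂ} {n : ℤ}

/-! ### Strongly disjoint trees -/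

/-- A family of pairwise disjoint trees that are strongly disjoint: if the frequency interval of a
tile `P` of one tree meets that of a shorter tile `Q` of another tree, then `Q` lies outside the
top interval of the tree of `P`. -/
structure IsForest (n : ℤ) (T : Finset Tile) (L : Finset Tree) : Prop where
  lac : ∀ t ∈ L, t.Lac n
  subset : ∀ t ∈ L, t.tiles ⊆ T
  disjoint : ∀ t ∈ L, ∀ s ∈ L, t ≠ s → Disjoint t.tiles s.tiles
  strong : ∀ t ∈ L, ∀ s ∈ L, t ≠ s → ∀ P ∈ t.tiles, ∀ Q ∈ s.tiles,
    Q.space.length < P.space.length → ∀ x ∈ P.freq.dilate 2, x ∈ Q.freq.dilate 2 →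
      Disjoint Q.space.toSet t.top.toSet

open Classical in
/-- All tiles of a family of trees. -/
def forestTiles (L : Finset Tree) : Finset Tile := L.biUnion Tree.tiles

lemma mem_forestTiles {L : Finset Tree} {P : Tile} :
    P ∈ forestTiles L ↔ ∃ t ∈ L, P ∈ t.tiles := by
  classical
  simp [forestTiles]

lemma IsForest.tiles_subset {L : Finset Tree} (hL : IsForest n T L) : forestTiles L ⊆ T := by
  intro P hP
  obtain ⟨t, ht, hPt⟩ := mem_forestTiles.1 hP
  exact hL.subset t ht hPt

lemma IsForest.sum_tiles {L : Finset Tree} (hL : IsForest n T L) (h : Tile → ℝ) :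
    ∑ P ∈ forestTiles L, h P = ∑ t ∈ L, ∑ P ∈ t.tiles, h P := by
  classical
  rw [forestTiles, Finset.sum_biUnion]
  exact fun t ht s hs hne => hL.disjoint t ht s hs hne

/-- The strong disjointness also for a tree and itself, where it holds vacuously. -/
lemma IsForest.disjoint_top (hn : (501 : ℝ) ≤ n) (hC : (n : ℝ) + 100 ≤ C₀) (hT : IsSparse C₀ T)
    {L : Finset Tree} (hL : IsForest n T L) {t : Tree} (ht : t ∈ L) {P Q : Tile}
    (hP : P ∈ t.tiles) (hQ : Q ∈ forestTiles L) (h : Q.space.length < P.space.length) {x : ℝ}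
    (hxP : x ∈ P.freq.dilate 2) (hxQ : x ∈ Q.freq.dilate 2) :
    Disjoint Q.space.toSet t.top.toSet := by
  obtain ⟨s, hs, hQs⟩ := mem_forestTiles.1 hQ
  by_cases hts : t = s
  · subst hts
    exact ((hL.lac t ht).not_meet hn hC hT (hL.subset t ht) hP hQs h hxP hxQ).elim
  · exact hL.strong t ht s hs hts P hP Q hQs h x hxP hxQ

/-- The tiles of a forest that are shorter than a tile `P` and whose frequency intervals meet that
of `P` are pairwise disjoint in space. -/
lemma IsForest.disjoint_of_meet (hn : (501 : ℝ) ≤ n) (hC : (n : ℝ) + 100 ≤ C₀)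
    (hT : IsSparse C₀ T) {L : Finset Tree} (hL : IsForest n T L) {P Q R : Tile} (hP : P ∈ T)
    (hQ : Q ∈ forestTiles L) (hR : R ∈ forestTiles L) (hQR : Q ≠ R)
    (hQP : Q.space.length < P.space.length) (hRP : R.space.length < P.space.length) {x y : ℝ}
    (hxP : x ∈ P.freq.dilate (5 / 4)) (hxQ : x ∈ Q.freq.dilate (5 / 4))
    (hyP : y ∈ P.freq.dilate (5 / 4)) (hyR : y ∈ R.freq.dilate (5 / 4)) :
    Disjoint Q.space.toSet R.space.toSet := by
  have hp := length_pos P.freq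
  -- The frequency interval of `P` is so short that a point of it moves into `2 ω_Q`.
  have near : ∀ {Q' : Tile} {u v : ℝ}, Q' ∈ T → Q'.space.length < P.space.length →
      u ∈ P.freq.dilate (5 / 4) → u ∈ Q'.freq.dilate (5 / 4) → v ∈ P.freq.dilate (5 / 4) →
      v ∈ Q'.freq.dilate 2 := by
    intro Q' u v hQ' hlt h1 h2 h3
    have h4 := freq_length_lt (by linarith) hT hP hQ' hlt
    have h5 : 100 * P.freq.length ≤ Q'.freq.length := by nlinarith
    rw [mem_dilate] at h1 h2 h3 ⊢
    constructor <;> linarith [h1.1, h1.2, h2.1, h2.2, h3.1, h3.2]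
  rcases lt_trichotomy Q.space.length R.space.length with h | h | h
  · obtain ⟨t, ht, hRt⟩ := mem_forestTiles.1 hR
    have hd := hL.disjoint_top hn hC hT ht hRt hQ h (dilate_mono _ (by norm_num) hyR)
      (near (hL.tiles_subset hQ) hQP hxP hxQ hyP)
    exact hd.mono_right ((hL.lac t ht) R hRt).1.1
  · refine disjoint_of_freq_eq hQR (freq_eq_of_inter (by linarith) hT (hL.tiles_subset hQ)
      (hL.tiles_subset hR) h.symm (x := x) (dilate_mono _ (by linarith) hxQ) ?_)
    exact dilate_mono _ (by linarith) (near (hL.tiles_subset hR) hRP hyP hyR hxP)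
  · obtain ⟨t, ht, hQt⟩ := mem_forestTiles.1 hQ
    have hd := hL.disjoint_top hn hC hT ht hQt hR h (dilate_mono _ (by norm_num) hxQ)
      (near (hL.tiles_subset hR) hRP hyP hyR hxP)
    exact (hd.mono_right ((hL.lac t ht) Q hQt).1.1).symm

/-- The weight that measures how far the center of `P` is from the end points of `I`, at the scale
of `P`. -/
def edgeDecay (I : DyadicInterval) (P : Tile) : ℝ :=
  decay (I.center - I.length / 2) P.space.length P.space.center +
    decay (I.center + I.length / 2) P.space.length P.space.center

lemma edgeDecay_nonneg (I : DyadicInterval) (P : Tile) : 0 ≤ edgeDecay I P :=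
  add_nonneg (decay_pos (length_pos _)).le (decay_pos (length_pos _)).le

/-- Interaction of the wave packet of a tile `P` with those of the shorter tiles: these are
disjoint from each other and from the top of the tree of `P`. -/
lemma IsForest.sum_shorter_le (hn : (501 : ℝ) ≤ n) (hC : (n : ℝ) + 100 ≤ C₀)
    (hT : IsSparse C₀ T) (hφ : ∀ P ∈ T, IsPacket K P (φ P)) {L : Finset Tree}
    (hL : IsForest n T L) {t : Tree} (ht : t ∈ L) {P : Tile} (hP : P ∈ t.tiles) :
    (∑ Q ∈ forestTiles L, if Q.space.length < P.space.length then
      Q.space.length * ‖coeff φ (φ Q) P‖ else 0) ≤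
      4 * Real.pi ^ 2 * K ^ 2 * edgeDecay t.top P := by
  classical
  have hp := length_pos P.space
  have hpi := Real.pi_pos
  have hPT := hL.subset t ht hP
  have hPI := center_mem_of_subset ((hL.lac t ht) P hP).1.1
  have hE := edgeDecay_nonneg t.top P
  calc _ ≤ ∑ Q ∈ forestTiles L, if Q.space.length < P.space.length ∧
          ∃ x, x ∈ P.freq.dilate (5 / 4) ∧ x ∈ Q.freq.dilate (5 / 4) then
          Real.pi * K ^ 2 / P.space.length * edgeDecay t.top P *
            (Q.space.length * decay P.space.center P.space.length Q.space.center) else 0 := by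
        refine Finset.sum_le_sum fun Q hQ => ?_
        have hQT := hL.tiles_subset hQ
        by_cases h1 : Q.space.length < P.space.length
        · rw [if_pos h1]
          by_cases h2 : ∃ x, x ∈ P.freq.dilate (5 / 4) ∧ x ∈ Q.freq.dilate (5 / 4)
          · rw [if_pos ⟨h1, h2⟩]
            obtain ⟨x, hxP, hxQ⟩ := h2
            have hdis := hL.disjoint_top hn hC hT ht hP hQ h1
              (dilate_mono _ (by norm_num) hxP) (dilate_mono _ (by norm_num) hxQ)
            have hout : ¬ (t.top.center - t.top.length / 2 ≤ Q.space.center ∧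
                Q.space.center < t.top.center + t.top.length / 2) := fun h =>
              Set.disjoint_left.1 hdis (center_mem _) (mem_toSet.2 h)
            have hq := length_pos Q.space
            have hd : 0 < decay P.space.center P.space.length Q.space.center := decay_pos hp
            have hedge : decay P.space.center P.space.length Q.space.center ≤
                edgeDecay t.top P := by
              rw [decay_comm]
              rcases not_and_or.1 hout with h | h
              · refine le_trans (decay_le_of_dist_le hp ?_)
                  (le_add_of_nonneg_right (decay_pos hp).le)
                rw [abs_of_nonneg (by linarith [hPI.1]), abs_of_nonneg (by linarith [hPI.1])]
                linarith
              · refine le_trans (decay_le_of_dist_le hp ?_)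
                  (le_add_of_nonneg_left (decay_pos hp).le)
                rw [abs_of_nonpos (by linarith [hPI.2]), abs_of_nonpos (by linarith [hPI.2])]
                linarith
            calc Q.space.length * ‖coeff φ (φ Q) P‖
                ≤ Q.space.length * (Real.pi * K ^ 2 / P.space.length *
                  decay P.space.center P.space.length Q.space.center ^ 2) := by
                  gcongr; exact (hφ P hPT).norm_integral_le (hφ Q hQT) h1.le
              _ = Real.pi * K ^ 2 / P.space.length *
                  decay P.space.center P.space.length Q.space.center *
                  (Q.space.length * decay P.space.center P.space.length Q.space.center) := by ring
              _ ≤ _ := by gcongr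
          · rw [if_neg (fun h => h2 h.2)]
            have h0 : coeff φ (φ Q) P = 0 :=
              (hφ P hPT).orthogonal (hφ Q hQT) fun ξ hξP hξQ => h2 ⟨ξ, hξP, hξQ⟩
            rw [h0]; simp
        · rw [if_neg h1, if_neg (fun h => h1 h.1)]
    _ = Real.pi * K ^ 2 / P.space.length * edgeDecay t.top P *
          ∑ Q ∈ forestTiles L with Q.space.length < P.space.length ∧
            ∃ x, x ∈ P.freq.dilate (5 / 4) ∧ x ∈ Q.freq.dilate (5 / 4),
            Q.space.length * decay P.space.center P.space.length Q.space.center := by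
        rw [Finset.mul_sum, Finset.sum_filter]
    _ ≤ Real.pi * K ^ 2 / P.space.length * edgeDecay t.top P * (4 * Real.pi * P.space.length) := by
        refine mul_le_mul_of_nonneg_left (packing hp ?_ ?_) (by positivity)
        · intro Q hQ
          exact (Finset.mem_filter.1 hQ).2.1.le
        · intro Q hQ R hR hne
          obtain ⟨hQL, hQP, x, hxP, hxQ⟩ := Finset.mem_filter.1 hQ
          obtain ⟨hRL, hRP, y, hyP, hyR⟩ := Finset.mem_filter.1 hR
          exact hL.disjoint_of_meet hn hC hT hPT hQL hRL hne hQP hRP hxP hxQ hyP hyR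
    _ = _ := by field_simp

/-- Few tiles of a tree are close to the boundary of its top interval. -/
lemma Tree.Lac.sum_edgeDecay_le (hn : (501 : ℝ) ≤ n) (hC : (n : ℝ) + 100 ≤ C₀)
    (hT : IsSparse C₀ T) {t : Tree} (ht : t.Lac n) (htT : t.tiles ⊆ T) :
    ∑ P ∈ t.tiles, P.space.length * edgeDecay t.top P ≤ 16 * Real.pi * t.top.length := by
  have hpi := Real.pi_pos
  have key : ∑ P ∈ t.tiles, P.space.length * edgeDecay t.top P ≤
      2 * (8 * Real.pi) * t.top.length := by
    refine sum_le_of_scales (I := t.top) (by positivity) (fun P hP => ht.length_le hP) ?_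
    intro R hR
    have hr := length_pos R.space
    have hlen : ∀ P ∈ ({P ∈ t.tiles | P.space.scale = R.space.scale} : Finset Tile),
        P.space.length = R.space.length := fun P hP => by
      rw [DyadicInterval.length, DyadicInterval.length, (Finset.mem_filter.1 hP).2]
    have hpack : ∀ c, ∑ P ∈ t.tiles with P.space.scale = R.space.scale,
        P.space.length * decay c R.space.length P.space.center ≤
        4 * Real.pi * R.space.length := fun c => by
      refine packing hr (fun P hP => (hlen P hP).le) fun P hP Q hQ hne => ?_
      refine ht.disjoint hn hC hT htT (Finset.mem_filter.1 hP).1 (Finset.mem_filter.1 hQ).1 ?_ hne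
      rw [hlen P hP, hlen Q hQ]
    have e : ∑ P ∈ t.tiles with P.space.scale = R.space.scale,
        P.space.length * edgeDecay t.top P =
        (∑ P ∈ t.tiles with P.space.scale = R.space.scale,
          P.space.length * decay (t.top.center - t.top.length / 2) R.space.length P.space.center) +
        ∑ P ∈ t.tiles with P.space.scale = R.space.scale,
          P.space.length * decay (t.top.center + t.top.length / 2) R.space.length
            P.space.center := by
      rw [← Finset.sum_add_distrib]
      refine Finset.sum_congr rfl fun P hP => ?_
      rw [edgeDecay, hlen P hP, mul_add]
    rw [e]
    linarith [hpack (t.top.center - t.top.length / 2), hpack (t.top.center + t.top.length / 2)]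
  linarith

lemma IsForest.crossTerms_le (hn : (501 : ℝ) ≤ n) (hC : (n : ℝ) + 100 ≤ C₀)
    (hT : IsSparse C₀ T) (hφ : ∀ P ∈ T, IsPacket K P (φ P)) {L : Finset Tree}
    (hL : IsForest n T L) {lam : ℝ} (hlam : 0 < lam)
    (hcoeff : ∀ P ∈ forestTiles L, ‖coeff φ f P‖ ≤ 2 * lam) :
    crossTerms φ f (forestTiles L) ≤
      256 * Real.pi ^ 3 * K ^ 2 * (lam ^ 2 * ∑ t ∈ L, t.top.length) := by
  have hpi := Real.pi_pos
  rw [crossTerms, hL.sum_tiles, Finset.mul_sum, Finset.mul_sum]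
  refine Finset.sum_le_sum fun t ht => ?_
  calc _ ≤ ∑ P ∈ t.tiles, 16 * Real.pi ^ 2 * K ^ 2 * lam ^ 2 *
          (P.space.length * edgeDecay t.top P) := by
        refine Finset.sum_le_sum fun P hP => ?_
        have hp := length_pos P.space
        calc _ ≤ ∑ Q ∈ forestTiles L, (2 * lam) * P.space.length * (2 * lam) *
              (if Q.space.length < P.space.length then
                Q.space.length * ‖coeff φ (φ Q) P‖ else 0) := by
              refine Finset.sum_le_sum fun Q hQ => ?_
              have hq := length_pos Q.space
              split_ifs
              · have h1 := hcoeff P (mem_forestTiles.2 ⟨t, ht, hP⟩)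
                have h2 := hcoeff Q hQ
                calc _ ≤ (2 * lam * P.space.length) * (2 * lam * Q.space.length) *
                      ‖coeff φ (φ Q) P‖ := by gcongr
                  _ = _ := by ring
              · simp
          _ ≤ (2 * lam) * P.space.length * (2 * lam) *
              (4 * Real.pi ^ 2 * K ^ 2 * edgeDecay t.top P) := by
              rw [← Finset.mul_sum]
              exact mul_le_mul_of_nonneg_left (hL.sum_shorter_le hn hC hT hφ ht hP) (by positivity)
          _ = _ := by ring
    _ ≤ 16 * Real.pi ^ 2 * K ^ 2 * lam ^ 2 * (16 * Real.pi * t.top.length) := by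
        rw [← Finset.mul_sum]
        exact mul_le_mul_of_nonneg_left
          ((hL.lac t ht).sum_edgeDecay_le hn hC hT (hL.subset t ht)) (by positivity)
    _ = _ := by ring

/-- The constant of the estimate for strongly disjoint trees, per wave packet constant. -/
def forestConst : ℝ := 4 * Real.pi ^ 2 + 512 * Real.pi ^ 3

/-- The top intervals of strongly disjoint trees whose mean energy is about `λ²` have total length
at most a multiple of `λ⁻² ‖f‖₂²`. -/
lemma IsForest.sum_top_le (hn : (501 : ℝ) ≤ n) (hC : (n : ℝ) + 100 ≤ C₀)
    (hT : IsSparse C₀ T) (hφ : ∀ P ∈ T, IsPacket K P (φ P)) {L : Finset Tree}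
    (hL : IsForest n T L) {lam : ℝ} (hlam : 0 < lam) (hf : MemLp f 2)
    (hcoeff : ∀ P ∈ forestTiles L, ‖coeff φ f P‖ ≤ 2 * lam)
    (hbig : ∀ t ∈ L, lam ^ 2 * t.top.length ≤ energy φ f t.tiles) :
    lam ^ 2 * ∑ t ∈ L, t.top.length ≤ forestConst * K ^ 2 * ∫ x, ‖f x‖ ^ 2 := by
  have hpi := Real.pi_pos
  have hsum : lam ^ 2 * ∑ t ∈ L, t.top.length ≤ energy φ f (forestTiles L) := by
    rw [energy, hL.sum_tiles, Finset.mul_sum]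
    exact Finset.sum_le_sum hbig
  refine hsum.trans ?_
  have hcross := hL.crossTerms_le hn hC hT hφ hlam hcoeff
  have hsq := energy_sq_le (by linarith) hT hφ hL.tiles_subset hf
  have hN : 0 ≤ ∫ x, ‖f x‖ ^ 2 := integral_nonneg fun x => by positivity
  have h1 : crossTerms φ f (forestTiles L) ≤
      256 * Real.pi ^ 3 * K ^ 2 * energy φ f (forestTiles L) :=
    hcross.trans (mul_le_mul_of_nonneg_left hsum (by positivity))
  have h2 : energy φ f (forestTiles L) ^ 2 ≤
      (∫ x, ‖f x‖ ^ 2) * (forestConst * K ^ 2 * energy φ f (forestTiles L)) := by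
    refine hsq.trans (mul_le_mul_of_nonneg_left ?_ hN)
    unfold forestConst
    linarith
  have hE := energy_nonneg φ f (forestTiles L)
  rcases hE.eq_or_lt with h | h
  · rw [← h]
    have : 0 ≤ forestConst := by unfold forestConst; positivity
    positivity
  · refine le_of_mul_le_mul_right ?_ h
    calc _ = energy φ f (forestTiles L) ^ 2 := (sq _).symm
      _ ≤ _ := h2
      _ = _ := by ring

/-! ### Selection of the trees -/

/-- Greedy selection: as long as there is a tree of mean energy more than `λ²`, such a tree with
almost minimal top frequency is selected, and all tiles of the generating set with the same top
data are removed. The almost minimality makes the selected trees strongly disjoint. -/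
lemma exists_forest (hn : (501 : ℝ) ≤ n) (hC : (n : ℝ) + 100 ≤ C₀) (hT : IsSparse C₀ T)
    (φ : Tile → ℝ → ℂ) (f : ℝ → ℂ) {lam δ : ℝ} (hδ : 0 < δ)
    (hδT : ∀ P ∈ T, δ ≤ P.freq.length) (Q : Finset Tile) (hQ : Q ⊆ T) :
    ∃ (L : Finset Tree) (F : Finset Tile), IsForest n T L ∧
      (∀ t ∈ L, t.tiles ⊆ Q ∧ lam ^ 2 * t.top.length < energy φ f t.tiles) ∧
      (∀ P ∈ F, P ∈ Q ∧ ∃ t ∈ L, Below n t.top t.xi P) ∧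
      ∀ t : Tree, t.Lac n → (∀ P ∈ t.tiles, P ∈ Q ∧ P ∉ F) →
        energy φ f t.tiles ≤ lam ^ 2 * t.top.length := by
  classical
  induction hN : Q.card using Nat.strong_induction_on generalizing Q with
  | _ N ih =>
  set X : Set ℝ := {ξ | ∃ t : Tree, t.Lac n ∧ t.tiles ⊆ Q ∧
    lam ^ 2 * t.top.length < energy φ f t.tiles ∧ t.xi = ξ}
  have nonempty_of_big : ∀ t : Tree, lam ^ 2 * t.top.length < energy φ f t.tiles →
      t.tiles.Nonempty := by
    intro t ht
    by_contra h
    rw [Finset.not_nonempty_iff_eq_empty.1 h] at ht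
    simp only [energy, Finset.sum_empty] at ht
    have := mul_nonneg (sq_nonneg lam) (length_pos t.top).le
    linarith
  by_cases hX : X.Nonempty
  swap
  · refine ⟨∅, ∅, ⟨by simp, by simp, by simp, by simp⟩, by simp, by simp, fun t ht hsub => ?_⟩
    by_contra hcon
    exact hX ⟨t.xi, t, ht, fun P hP => (hsub P hP).1, not_le.1 hcon, rfl⟩
  have hbdd : BddBelow X := by
    have : X ⊆ ⋃ P ∈ (Q : Set Tile), (P.upper n).dilate 50 := by
      rintro ξ ⟨t, ht, hsub, hbig, rfl⟩
      obtain ⟨P, hP⟩ := nonempty_of_big t hbig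
      exact Set.mem_biUnion (hsub hP) (ht P hP).2
    refine BddBelow.mono this ?_
    rw [Q.finite_toSet.bddBelow_biUnion]
    exact fun P _ => bddBelow_Ico
  obtain ⟨_, ⟨t, ht, htQ, hbig, rfl⟩, hmin⟩ :=
    exists_lt_of_csInf_lt hX (show sInf X < sInf X + δ by linarith)
  set E := Q.filter (Below n t.top t.xi)
  have htE : t.tiles ⊆ E := fun P hP => Finset.mem_filter.2 ⟨htQ hP, (ht P hP).1⟩
  obtain ⟨P₀, hP₀⟩ := nonempty_of_big t hbig
  have hcard : (Q \ E).card < N := by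
    rw [← hN]
    refine Finset.card_lt_card ⟨Finset.sdiff_subset, fun h => ?_⟩
    exact (Finset.mem_sdiff.1 (h (htQ hP₀))).2 (htE hP₀)
  obtain ⟨L, F, hL, hLbig, hF, hrest⟩ := ih _ hcard (Q \ E) (Finset.sdiff_subset.trans hQ) rfl
  have hLQ : ∀ s ∈ L, ∀ R ∈ s.tiles, R ∈ Q ∧ R ∉ E := fun s hs R hR =>
    Finset.mem_sdiff.1 ((hLbig s hs).1 hR)
  have hxi : ∀ s ∈ L, t.xi < s.xi + δ := fun s hs => by
    have : sInf X ≤ s.xi := csInf_le hbdd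
      ⟨s, hL.lac s hs, fun R hR => (hLQ s hs R hR).1, (hLbig s hs).2, rfl⟩
    linarith
  have hdisj : ∀ s ∈ L, Disjoint t.tiles s.tiles := fun s hs =>
    Finset.disjoint_left.2 fun R hR hRs => (hLQ s hs R hRs).2 (htE hR)
  refine ⟨insert t L, E ∪ F, ⟨?_, ?_, ?_, ?_⟩, ?_, ?_, ?_⟩
  · intro s hs
    rcases Finset.mem_insert.1 hs with rfl | hs
    exacts [ht, hL.lac s hs]
  · intro s hs
    rcases Finset.mem_insert.1 hs with rfl | hs
    exacts [htQ.trans hQ, hL.subset s hs]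
  · intro s hs r hr hne
    rcases Finset.mem_insert.1 hs with rfl | hs' <;> rcases Finset.mem_insert.1 hr with rfl | hr'
    · exact absurd rfl hne
    · exact hdisj r hr'
    · exact (hdisj s hs').symm
    · exact hL.disjoint s hs' r hr' hne
  · intro s hs r hr hne P hP R hR hlt x hxP hxR
    rcases Finset.mem_insert.1 hs with rfl | hs' <;> rcases Finset.mem_insert.1 hr with rfl | hr'
    · exact absurd rfl hne
    · -- A tile `R` inside the top interval would have been removed together with the tree.
      have hRQ := hLQ r hr' R hR
      have hnear := ht.xi_near hn hC hT (htQ.trans hQ) hP (hQ hRQ.1) hlt hxP hxR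
      rw [Set.disjoint_left]
      intro y hyR hyt
      refine hRQ.2 (Finset.mem_filter.2 ⟨hRQ.1, ?_, hnear.2⟩)
      exact subset_of_inter (hlt.le.trans (ht.length_le hP)) hyR hyt
    · -- The first tree has almost minimal top frequency, so that this case does not occur.
      exfalso
      have hnear := (hL.lac s hs').xi_near hn hC hT (hL.subset s hs') hP (hQ (htQ hR)) hlt hxP hxR
      have h1 := (ht.xi_bounds hR).1
      have h2 := hxi s hs'
      have h3 := hδT R (hQ (htQ hR))
      have h4 := length_pos R.freq
      nlinarith [hnear.1]
    · exact hL.strong s hs' r hr' hne P hP R hR hlt x hxP hxR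
  · intro s hs
    rcases Finset.mem_insert.1 hs with rfl | hs
    · exact ⟨htQ, hbig⟩
    · exact ⟨fun R hR => (hLQ s hs R hR).1, (hLbig s hs).2⟩
  · intro P hP
    rcases Finset.mem_union.1 hP with hP | hP
    · obtain ⟨h1, h2⟩ := Finset.mem_filter.1 hP
      exact ⟨h1, t, Finset.mem_insert_self _ _, h2⟩
    · obtain ⟨h1, s, hs, h2⟩ := hF P hP
      exact ⟨(Finset.mem_sdiff.1 h1).1, s, Finset.mem_insert_of_mem hs, h2⟩
  · intro s hs hsub
    refine hrest s hs fun P hP => ?_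
    obtain ⟨h1, h2⟩ := hsub P hP
    rw [Finset.mem_union, not_or] at h2
    exact ⟨Finset.mem_sdiff.2 ⟨h1, h2.1⟩, h2.2⟩

/-- A set of tiles covered by generating sets whose top intervals have total length at most `m`. -/
def CoveredBy (n : ℤ) (F : Set Tile) (m : ℝ) : Prop :=
  ∃ L : List (DyadicInterval × ℝ), (∀ P ∈ F, ∃ a ∈ L, Below n a.1 a.2 P) ∧
    (L.map fun a => a.1.length).sum ≤ m

lemma CoveredBy.union {F G : Set Tile} {m k : ℝ} (hF : CoveredBy n F m) (hG : CoveredBy n G k) :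
    CoveredBy n (F ∪ G) (m + k) := by
  obtain ⟨L, h1, h2⟩ := hF
  obtain ⟨M, h3, h4⟩ := hG
  refine ⟨L ++ M, ?_, by rw [List.map_append, List.sum_append]; linarith⟩
  rintro P (hP | hP)
  · obtain ⟨a, ha, h⟩ := h1 P hP
    exact ⟨a, List.mem_append_left _ ha, h⟩
  · obtain ⟨a, ha, h⟩ := h3 P hP
    exact ⟨a, List.mem_append_right _ ha, h⟩

/-- The trees with tiles in `Q` have mean energy at most `λ²`: the lacunary size is at most `λ` on
`Q`. -/
def SizeLE (n : ℤ) (φ : Tile → ℝ → ℂ) (f : ℝ → ℂ) (Q : Set Tile) (lam : ℝ) : Prop :=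
  ∀ t : Tree, t.Lac n → (∀ P ∈ t.tiles, P ∈ Q) → energy φ f t.tiles ≤ lam ^ 2 * t.top.length

lemma SizeLE.norm_coeff_le {Q : Set Tile} {lam : ℝ} (h : SizeLE n φ f Q lam) (hlam : 0 ≤ lam)
    {P : Tile} (hP : P ∈ Q) : ‖coeff φ f P‖ ≤ lam := by
  have := h _ (lac_singleton n P) (by simpa using hP)
  simp only [energy, Finset.sum_singleton] at this
  exact le_of_sq_le_sq (le_of_mul_le_mul_right this (length_pos _)) hlam

/-- One step of the weak type estimate: passing from coefficients at most `2 λ` to size at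
most `λ`. -/
lemma exists_covered_step (hn : (501 : ℝ) ≤ n) (hC : (n : ℝ) + 100 ≤ C₀) (hT : IsSparse C₀ T)
    (hφ : ∀ P ∈ T, IsPacket K P (φ P)) (hf : MemLp f 2) {lam : ℝ} (hlam : 0 < lam)
    {Q : Set Tile} (hQT : Q ⊆ T) (hcoeff : ∀ P ∈ Q, ‖coeff φ f P‖ ≤ 2 * lam) :
    ∃ F : Set Tile, CoveredBy n F (forestConst * K ^ 2 * (∫ x, ‖f x‖ ^ 2) / lam ^ 2) ∧
      SizeLE n φ f (Q \ F) lam := by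
  classical
  obtain ⟨δ, hδ, hδT⟩ : ∃ δ : ℝ, 0 < δ ∧ ∀ P ∈ T, δ ≤ P.freq.length := by
    rcases T.eq_empty_or_nonempty with rfl | hne
    · exact ⟨1, one_pos, by simp⟩
    · obtain ⟨P, _, hmin⟩ := T.exists_min_image (fun P => P.freq.length) hne
      exact ⟨_, length_pos P.freq, hmin⟩
  obtain ⟨L, F, hL, hbig, hF, hrest⟩ := exists_forest hn hC hT φ f (lam := lam) hδ hδT
    (T.filter (· ∈ Q)) (Finset.filter_subset _ _)
  refine ⟨F, ⟨L.toList.map fun t => (t.top, t.xi), ?_, ?_⟩, ?_⟩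
  · intro P hP
    obtain ⟨_, t, ht, h⟩ := hF P hP
    exact ⟨(t.top, t.xi), List.mem_map.2 ⟨t, Finset.mem_toList.2 ht, rfl⟩, h⟩
  · have key := hL.sum_top_le hn hC hT hφ hlam hf (fun P hP => by
      obtain ⟨t, ht, hPt⟩ := mem_forestTiles.1 hP
      exact hcoeff P (Finset.mem_filter.1 ((hbig t ht).1 hPt)).2) (fun t ht => (hbig t ht).2.le)
    rw [List.map_map, le_div_iff₀ (by positivity), mul_comm]
    simpa [Function.comp_def, Finset.sum_map_toList] using key
  · intro t ht hsub
    exact hrest t ht fun P hP =>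
      ⟨Finset.mem_filter.2 ⟨hQT (hsub P hP).1, (hsub P hP).1⟩, (hsub P hP).2⟩

/-- The weak type `(2, 2)` estimate, by induction on the number of dyadic steps from the largest
coefficient down to `λ`. -/
lemma exists_covered (hn : (501 : ℝ) ≤ n) (hC : (n : ℝ) + 100 ≤ C₀) (hT : IsSparse C₀ T)
    (hφ : ∀ P ∈ T, IsPacket K P (φ P)) (hf : MemLp f 2) {lam : ℝ} (hlam : 0 < lam) :
    ∃ F : Set Tile, CoveredBy n F (2 * (forestConst * K ^ 2 * ∫ x, ‖f x‖ ^ 2) / lam ^ 2) ∧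
      SizeLE n φ f (T \ F) lam := by
  set c := forestConst * K ^ 2 * ∫ x, ‖f x‖ ^ 2
  have hc : 0 ≤ c := by
    have hN : 0 ≤ ∫ x, ‖f x‖ ^ 2 := integral_nonneg fun x => by positivity
    have := Real.pi_pos
    have : 0 ≤ forestConst := by unfold forestConst; positivity
    positivity
  have main : ∀ k : ℕ, ∀ lam : ℝ, 0 < lam → (∀ P ∈ T, ‖coeff φ f P‖ ≤ 2 ^ k * lam) →
      ∃ F : Set Tile, CoveredBy n F (2 * c / lam ^ 2) ∧ SizeLE n φ f (T \ F) lam := by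
    intro k
    induction k with
    | zero =>
      intro lam hlam h
      obtain ⟨F, hF, hs⟩ := exists_covered_step hn hC hT hφ hf hlam (subset_refl (T : Set Tile))
        fun P hP => (h P hP).trans (by linarith)
      refine ⟨F, ?_, hs⟩
      obtain ⟨L, h1, h2⟩ := hF
      refine ⟨L, h1, h2.trans ?_⟩
      refine div_le_div_of_nonneg_right ?_ (by positivity)
      change c ≤ 2 * c
      linarith
    | succ k ih =>
      intro lam hlam h
      obtain ⟨F, hF, hs⟩ := ih (2 * lam) (by linarith) fun P hP => (h P hP).trans_eq (by ring)
      obtain ⟨G, hG, hs'⟩ := exists_covered_step hn hC hT hφ hf hlam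
        (Q := (T : Set Tile) \ F) Set.sdiff_subset fun P hP => hs.norm_coeff_le (by linarith) hP
      refine ⟨F ∪ G, ?_, by rwa [Set.sdiff_sdiff] at hs'⟩
      obtain ⟨L, h1, h2⟩ := hF.union hG
      refine ⟨L, h1, h2.trans ?_⟩
      -- The total `2 c / λ²` reproduces itself, since the step down to `2 λ` costs a quarter of it.
      have e : 2 * c / lam ^ 2 - (2 * c / (2 * lam) ^ 2 + c / lam ^ 2) = c / (2 * lam ^ 2) := by
        field_simp; ring
      have : 0 ≤ c / (2 * lam ^ 2) := by positivity
      change 2 * c / (2 * lam) ^ 2 + c / lam ^ 2 ≤ _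
      linarith
  obtain ⟨k, hk⟩ : ∃ k : ℕ, (∑ P ∈ T, ‖coeff φ f P‖) / lam < 2 ^ k :=
    pow_unbounded_of_one_lt _ (by norm_num)
  refine main k lam hlam fun P hP => ?_
  rw [div_lt_iff₀ hlam] at hk
  exact (Finset.single_le_sum (f := fun P => ‖coeff φ f P‖) (fun _ _ => norm_nonneg _) hP).trans
    hk.le

end

section

variable {C₀ K : ℝ} {T : Finset Tile} {φ : Tile → ℝ → ℂ} {f : ℝ → ℂ} {n : ℤ}

/-! ### The outer measure space -/

lemma outerMeas_below_le (n : ℤ) (T : Finset Tile) (I : DyadicInterval) (ξ : ℝ) :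
    TileSpace.outerMeas n T {P | Below n I ξ P.1} ≤ ENNReal.ofReal I.length := by
  refine (OuterMeasure.ofFunction_le _).trans ?_
  rw [TileSpace.premeasure]
  split_ifs with h
  · exact zero_le
  · exact iInf₂_le_of_le I ξ (iInf_le_of_le ⟨Set.nonempty_iff_ne_empty.2 h, fun P hP => hP.1,
      fun P hP => hP.2⟩ le_rfl)

lemma CoveredBy.outerMeas_le {F : Set Tile} {m : ℝ} (h : CoveredBy n F m) :
    TileSpace.outerMeas n T (Subtype.val ⁻¹' F) ≤ ENNReal.ofReal m := by
  obtain ⟨L, hL, hm⟩ := h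
  have main : ∀ M : List (DyadicInterval × ℝ),
      TileSpace.outerMeas n T {P | ∃ a ∈ M, Below n a.1 a.2 P.1} ≤
        ENNReal.ofReal (M.map fun a => a.1.length).sum := by
    intro M
    induction M with
    | nil => simp
    | cons a M ih =>
      have e : {P : T | ∃ b ∈ a :: M, Below n b.1 b.2 P.1} =
          {P | Below n a.1 a.2 P.1} ∪ {P | ∃ b ∈ M, Below n b.1 b.2 P.1} := by
        ext P; simp
      rw [e, List.map_cons, List.sum_cons, ENNReal.ofReal_add (length_pos _).le
        (List.sum_nonneg fun x hx => by
          obtain ⟨b, _, rfl⟩ := List.mem_map.1 hx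
          exact (length_pos _).le)]
      exact (measure_union_le _ _).trans (add_le_add (outerMeas_below_le n T _ _) ih)
  calc _ ≤ TileSpace.outerMeas n T {P | ∃ a ∈ L, Below n a.1 a.2 P.1} :=
        measure_mono fun P hP => hL P.1 hP
    _ ≤ _ := (main L).trans (ENNReal.ofReal_le_ofReal hm)

/-- A bound for the energy of the trees outside `F` is a bound for the outer supremum outside
`F`. -/
lemma SizeLE.outSup_le {F : Set Tile} {lam : ℝ} (hlam : 0 ≤ lam)
    (h : SizeLE n φ f ((T : Set Tile) \ F) lam) :
    OuterLp.outSup (TileSpace.generating n T) (TileSpace.sizeLac n T 2)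
      ((Subtype.val ⁻¹' F : Set T)ᶜ.indicator (waveCoeff T φ f)) ≤ ENNReal.ofReal lam := by
  classical
  refine iSup₂_le fun E _ => iSup₂_le fun S _ => iSup₂_le fun I ξ => iSup_le fun hS => ?_
  have hl := length_pos I
  set t : Tree := ⟨(Finset.univ.filter fun P : T => P ∈ S ∧ P.1 ∉ F).map
    (Function.Embedding.subtype _), I, ξ⟩
  have ht : t.Lac n := by
    intro P hP
    obtain ⟨R, hR, rfl⟩ := Finset.mem_map.1 hP
    have hRS := (Finset.mem_filter.1 hR).2.1
    exact ⟨⟨hS.space_subset R hRS, hS.freq_subset R hRS⟩, hS.mem_upper R hRS⟩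
  have key := h t ht fun P hP => by
    obtain ⟨R, hR, rfl⟩ := Finset.mem_map.1 hP
    exact ⟨R.2, (Finset.mem_filter.1 hR).2.2⟩
  have e : ∑' P : S, ‖(Subtype.val ⁻¹' F : Set T)ᶜ.indicator (waveCoeff T φ f) P.1‖ₑ ^ (2 : ℝ) *
      ENNReal.ofReal P.1.1.space.length = ENNReal.ofReal (energy φ f t.tiles) := by
    rw [tsum_subtype S fun P : T =>
      ‖(Subtype.val ⁻¹' F : Set T)ᶜ.indicator (waveCoeff T φ f) P‖ₑ ^ (2 : ℝ) *
        ENNReal.ofReal P.1.space.length, tsum_fintype, energy, Finset.sum_map, Finset.sum_filter,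
      ENNReal.ofReal_sum_of_nonneg]
    · refine Finset.sum_congr rfl fun P _ => ?_
      by_cases h1 : P ∈ S
      · by_cases h2 : P.1 ∈ F
        · simp [h1, h2]
        · have h3 : P ∈ (Subtype.val ⁻¹' F : Set T)ᶜ := h2
          rw [Set.indicator_of_mem h1, Set.indicator_of_mem h3, if_pos ⟨h1, h2⟩,
            ENNReal.ofReal_mul (by positivity), ENNReal.ofReal_pow (norm_nonneg _),
            ofReal_norm, ← ENNReal.rpow_natCast]
          rfl
      · simp [h1]
    · intro P _
      split_ifs
      · exact mul_nonneg (by positivity) (length_pos _).le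
      · exact le_rfl
  rw [e]
  calc ((ENNReal.ofReal I.length)⁻¹ * ENNReal.ofReal (energy φ f t.tiles)) ^ (1 / 2 : ℝ)
      ≤ ((ENNReal.ofReal I.length)⁻¹ * ENNReal.ofReal (lam ^ 2 * I.length)) ^ (1 / 2 : ℝ) := by
        gcongr
    _ = ENNReal.ofReal lam := by
        rw [← ENNReal.ofReal_inv_of_pos hl, ← ENNReal.ofReal_mul (by positivity),
          ENNReal.ofReal_rpow_of_nonneg (by positivity) (by norm_num)]
        congr 1
        rw [mul_comm, mul_assoc, mul_inv_cancel₀ hl.ne', mul_one, ← Real.sqrt_eq_rpow,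
          Real.sqrt_sq hlam]

lemma superLevel_le {F : Set Tile} {lam m : ℝ} (hlam : 0 ≤ lam)
    (h : SizeLE n φ f ((T : Set Tile) \ F) lam) (hF : CoveredBy n F m) :
    OuterLp.superLevel (TileSpace.outerMeas n T) (TileSpace.generating n T)
      (TileSpace.sizeLac n T 2) (waveCoeff T φ f) (ENNReal.ofReal lam) ≤ ENNReal.ofReal m :=
  iInf₂_le_of_le (Subtype.val ⁻¹' F) (h.outSup_le hlam) hF.outerMeas_le

lemma waveCoeff_congr {g : ℝ → ℂ} (h : f =ᵐ[volume] g) : waveCoeff T φ f = waveCoeff T φ g := by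
  ext P
  exact integral_congr_ae (h.mono fun x hx => by simp only [hx])

lemma bddConst_nonneg : 0 ≤ bddConst := by
  have := Real.pi_pos
  unfold bddConst; positivity

lemma forestConst_nonneg : 0 ≤ forestConst := by
  have := Real.pi_pos
  unfold forestConst; positivity

/-! ### The endpoint estimates -/

lemma strongNorm_top_le (hn : (501 : ℝ) ≤ n) (hC : (n : ℝ) + 100 ≤ C₀) (hT : IsSparse C₀ T)
    (hφ : ∀ P ∈ T, IsPacket K P (φ P)) (hf : MemLp f ∞) :
    OuterLp.outSup (TileSpace.generating n T) (TileSpace.sizeLac n T 2) (waveCoeff T φ f) ≤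
      ENNReal.ofReal (√bddConst * |K|) * eLpNorm f ∞ := by
  have hM : ∀ᵐ x, ‖f x‖ ≤ (eLpNorm f ∞).toReal := by
    filter_upwards [ae_le_eLpNormEssSup (f := f) (μ := volume)] with x hx
    rw [← eLpNorm_exponent_top, ← ofReal_norm] at hx
    exact (ENNReal.ofReal_le_iff_le_toReal hf.eLpNorm_ne_top).1 hx
  have hs : SizeLE n φ f ((T : Set Tile) \ ∅) (√bddConst * |K| * (eLpNorm f ∞).toReal) := by
    intro t ht hsub
    refine (ht.energy_le_of_bound hn hC hT hφ (fun P hP => (hsub P hP).1) ENNReal.toReal_nonneg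
      hf.1 hM).trans_eq ?_
    rw [mul_pow, mul_pow, Real.sq_sqrt bddConst_nonneg, sq_abs]
  have := hs.outSup_le (by positivity)
  rw [ENNReal.ofReal_mul (by positivity), ENNReal.ofReal_toReal hf.eLpNorm_ne_top] at this
  simpa using this

lemma weakNorm_two_le (hn : (501 : ℝ) ≤ n) (hC : (n : ℝ) + 100 ≤ C₀) (hT : IsSparse C₀ T)
    (hφ : ∀ P ∈ T, IsPacket K P (φ P)) (hf : MemLp f 2) :
    OuterLp.weakNorm (TileSpace.outerMeas n T) (TileSpace.generating n T)
      (TileSpace.sizeLac n T 2) 2 (waveCoeff T φ f) ≤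
      ENNReal.ofReal (√(2 * forestConst) * |K|) * eLpNorm f 2 := by
  have hfc := forestConst_nonneg
  have hfin := hf.eLpNorm_ne_top
  obtain ⟨N, hN0, hN⟩ : ∃ N : ℝ, 0 ≤ N ∧ eLpNorm f 2 = ENNReal.ofReal N := by
    refine ⟨(eLpNorm f 2).toReal, ENNReal.toReal_nonneg, ?_⟩
    rw [ENNReal.ofReal_toReal hfin]
  have hN2 : ∫ x, ‖f x‖ ^ 2 = N ^ 2 := by
    rw [← norm_toLp_sq hf, Lp.norm_toLp, hN, ENNReal.toReal_ofReal hN0]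
  rw [hN, ← ENNReal.ofReal_mul (by positivity)]
  set a := √(2 * forestConst) * |K| with ha
  have ha0 : 0 ≤ a := by positivity
  have ha2 : a ^ 2 = 2 * forestConst * K ^ 2 := by
    rw [ha, mul_pow, Real.sq_sqrt (by positivity), sq_abs]
  refine iSup₂_le fun t ht => ?_
  obtain ⟨F, hF, hs⟩ := exists_covered hn hC hT hφ hf ht
  have h1 := superLevel_le ht.le hs hF
  have e : 2 * (forestConst * K ^ 2 * ∫ x, ‖f x‖ ^ 2) / t ^ 2 = (a * N / t) ^ 2 := by
    rw [hN2, div_pow, mul_pow, ha2]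
    ring
  rw [e] at h1
  have h2 : 0 ≤ a * N / t := by positivity
  calc _ ≤ ENNReal.ofReal t * ENNReal.ofReal ((a * N / t) ^ 2) ^ (1 / 2 : ℝ) :=
        mul_le_mul_right (ENNReal.rpow_le_rpow h1 (by norm_num)) _
    _ = ENNReal.ofReal (a * N) := by
        rw [ENNReal.ofReal_rpow_of_nonneg (by positivity) (by norm_num), ← Real.sqrt_eq_rpow,
          Real.sqrt_sq h2, ← ENNReal.ofReal_mul ht.le, mul_div_cancel₀ _ ht.ne']

/-! ### Interpolation -/

/-- The super level measure at height `t` only sees the part of `f` above a multiple of `t`: the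
remaining part contributes at most `t / 2` to the size. -/
lemma superLevel_le_lintegral (hn : (501 : ℝ) ≤ n) (hC : (n : ℝ) + 100 ≤ C₀) (hT : IsSparse C₀ T)
    (hφ : ∀ P ∈ T, IsPacket K P (φ P)) (hfm : StronglyMeasurable f) {p : ℝ≥0∞} (hp : 2 < p)
    (hp' : p ≠ ∞) (hf : MemLp f p) {c : ℝ} (hc : 0 < c) (hcK : 4 * bddConst * K ^ 2 * c ^ 2 ≤ 1)
    {t : ℝ} (ht : 0 < t) :
    OuterLp.superLevel (TileSpace.outerMeas n T) (TileSpace.generating n T)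
      (TileSpace.sizeLac n T 2) (waveCoeff T φ f) (ENNReal.ofReal t) ≤
      ENNReal.ofReal (8 * forestConst * K ^ 2) * ENNReal.ofReal (t ^ (-2 : ℝ)) *
        ∫⁻ x in {x | t < ‖f x‖ / c}, ‖f x‖ₑ ^ (2 : ℝ) := by
  set H : Set ℝ := {x | t < ‖f x‖ / c}
  have hct : 0 < t * c := by positivity
  have hH : ∀ x, x ∈ H ↔ t * c < ‖f x‖ := fun x => lt_div_iff₀ hc
  have hHm : MeasurableSet H :=
    measurableSet_lt measurable_const (hfm.norm.measurable.div_const c)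
  have hHv : volume H ≠ ∞ := by
    have := hf.meas_ge_lt_top (zero_lt_two.trans hp).ne' hp' (Real.toNNReal_pos.2 hct).ne'
    refine ((measure_mono fun x hx => ?_).trans_lt this).ne
    exact Real.toNNReal_le_iff_le_coe.2 ((hH x).1 hx).le
  have h2 : MemLp (H.indicator f) 2 :=
    (hf.indicator hHm).mono_exponent_of_measure_support_ne_top
      (fun x hx => Set.indicator_of_notMem hx f) hHv hp.le
  have hb : ∀ᵐ x, ‖Hᶜ.indicator f x‖ ≤ t * c := .of_forall fun x => by
    by_cases hx : x ∈ H
    · simp [hx, hct.le]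
    · rw [Set.indicator_of_mem (show x ∈ Hᶜ from hx)]
      exact not_lt.1 fun h => hx ((hH x).2 h)
  have hm2 : AEStronglyMeasurable (Hᶜ.indicator f) :=
    (hfm.indicator hHm.compl).aestronglyMeasurable
  obtain ⟨F, hF, hs⟩ := exists_covered hn hC hT hφ h2 (half_pos ht)
  have hs' : SizeLE n φ f ((T : Set Tile) \ F) t := by
    intro s hslac hsub
    have hsT : s.tiles ⊆ T := fun P hP => (hsub P hP).1
    have hl := length_pos s.top
    have hadd := energy_add_le (φ := φ) (D := s.tiles) (f := H.indicator f) (g := Hᶜ.indicator f)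
      fun P hP => coeff_add ((hφ P (hsT hP)).integrable_mul_of_two h2)
        ((hφ P (hsT hP)).integrable_mul_of_bound hm2 hb)
    rw [Set.indicator_self_add_compl H f] at hadd
    have h3 := hs s hslac hsub
    have h4 := hslac.energy_le_of_bound hn hC hT hφ hsT hct.le hm2 hb
    have h5 := mul_le_mul_of_nonneg_right hcK (show 0 ≤ t ^ 2 * s.top.length by positivity)
    nlinarith
  refine (superLevel_le ht.le hs' hF).trans_eq ?_
  have hsq : ENNReal.ofReal (∫ x, ‖H.indicator f x‖ ^ 2) = ∫⁻ x in H, ‖f x‖ₑ ^ (2 : ℝ) := by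
    rw [ofReal_integral_eq_lintegral_ofReal
      ((memLp_two_iff_integrable_sq_norm h2.1).1 h2) (.of_forall fun x => by positivity),
      ← lintegral_indicator hHm]
    congr 1
    ext x
    by_cases hx : x ∈ H
    · simp only [hx, Set.indicator_of_mem]
      rw [ENNReal.ofReal_pow (norm_nonneg _), ofReal_norm, ← ENNReal.rpow_natCast]
      rfl
    · simp [hx]
  have hfc := forestConst_nonneg
  rw [← hsq, ← ENNReal.ofReal_mul (by positivity), ← ENNReal.ofReal_mul (by positivity)]
  congr 1
  rw [Real.rpow_neg ht.le, Real.rpow_two]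
  field_simp
  ring

/-- Integration of the distributional estimate over all heights, by the layer cake formula for the
measure `|f|² dx`. -/
lemma lintegral_layer (hfm : StronglyMeasurable f) {q c : ℝ} (hq : 2 < q) (hc : 0 < c) :
    ENNReal.ofReal (q - 2) * ∫⁻ t in Set.Ioi (0 : ℝ),
      (∫⁻ x in {x | t < ‖f x‖ / c}, ‖f x‖ₑ ^ (2 : ℝ)) * ENNReal.ofReal (t ^ (q - 2 - 1)) =
      ENNReal.ofReal (c ^ (2 - q)) * ∫⁻ x, ‖f x‖ₑ ^ q := by
  have hmeas : Measurable fun x => ‖f x‖ₑ ^ (2 : ℝ) := hfm.enorm.pow_const 2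
  have key := lintegral_rpow_eq_lintegral_meas_lt_mul
    (volume.withDensity fun x => ‖f x‖ₑ ^ (2 : ℝ)) (f := fun x => ‖f x‖ / c)
    (.of_forall fun x => by simp only [Pi.zero_apply]; positivity)
    (hfm.norm.measurable.div_const c).aemeasurable (p := q - 2) (by linarith)
  have hset : ∀ t : ℝ, MeasurableSet {x | t < ‖f x‖ / c} := fun t =>
    measurableSet_lt measurable_const (hfm.norm.measurable.div_const c)
  simp only [withDensity_apply _ (hset _)] at key
  rw [← key, lintegral_withDensity_eq_lintegral_mul _ hmeas
    (((hfm.norm.measurable.div_const c).pow_const _).ennreal_ofReal),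
    ← lintegral_const_mul' _ _ ENNReal.ofReal_ne_top]
  congr 1
  ext x
  rw [Pi.mul_apply, Real.div_rpow (norm_nonneg _) hc.le, div_eq_mul_inv, ← Real.rpow_neg hc.le,
    neg_sub, ENNReal.ofReal_mul (by positivity), mul_comm (ENNReal.ofReal _), mul_left_comm,
    ← ENNReal.ofReal_rpow_of_nonneg (norm_nonneg _) (by linarith), ofReal_norm,
    ← ENNReal.rpow_add_of_nonneg _ _ (by norm_num) (by linarith)]
  congr 2
  ring

/-- The constant in the strong type estimate, as a function of the exponent `q`, the wave packet
constant `K` and the height `c` at which functions are truncated. -/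
def strongConst (q K c : ℝ) : ℝ :=
  q * (8 * forestConst * K ^ 2) * (q - 2)⁻¹ * c ^ (2 - q)

lemma strongNorm_le_of_measurable (hn : (501 : ℝ) ≤ n) (hC : (n : ℝ) + 100 ≤ C₀)
    (hT : IsSparse C₀ T) (hφ : ∀ P ∈ T, IsPacket K P (φ P)) (hfm : StronglyMeasurable f)
    {p : ℝ≥0∞} (hp : 2 < p) (hp' : p ≠ ∞) (hf : MemLp f p) {c : ℝ} (hc : 0 < c)
    (hcK : 4 * bddConst * K ^ 2 * c ^ 2 ≤ 1) :
    OuterLp.strongNorm (TileSpace.outerMeas n T) (TileSpace.generating n T)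
      (TileSpace.sizeLac n T 2) p (waveCoeff T φ f) ≤
      ENNReal.ofReal (strongConst p.toReal K c) ^ (1 / p.toReal) * eLpNorm f p := by
  set q := p.toReal
  have hq : 2 < q := (ENNReal.toReal_lt_toReal (by simp) hp').2 hp
  have hpq : p = ENNReal.ofReal q := (ENNReal.ofReal_toReal hp').symm
  have hfc := forestConst_nonneg
  have hq2 : 0 < q - 2 := by linarith
  rw [OuterLp.strongNorm, if_neg hp', eLpNorm_eq_lintegral_rpow_enorm_toReal
    (zero_lt_two.trans hp).ne' hp', ← ENNReal.mul_rpow_of_nonneg _ _ (by positivity)]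
  refine ENNReal.rpow_le_rpow ?_ (by positivity)
  set a := ENNReal.ofReal (8 * forestConst * K ^ 2)
  set J := ∫⁻ t in Set.Ioi (0 : ℝ),
      (∫⁻ x in {x | t < ‖f x‖ / c}, ‖f x‖ₑ ^ (2 : ℝ)) * ENNReal.ofReal (t ^ (q - 2 - 1))
  have hJ : J = (ENNReal.ofReal (q - 2))⁻¹ *
      (ENNReal.ofReal (c ^ (2 - q)) * ∫⁻ x, ‖f x‖ₑ ^ q) := by
    rw [← lintegral_layer hfm hq hc, ← mul_assoc, ENNReal.inv_mul_cancel
      (by simpa using hq) ENNReal.ofReal_ne_top, one_mul]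
  calc _ ≤ p * ∫⁻ t in Set.Ioi (0 : ℝ), a *
        ((∫⁻ x in {x | t < ‖f x‖ / c}, ‖f x‖ₑ ^ (2 : ℝ)) * ENNReal.ofReal (t ^ (q - 2 - 1))) := by
        refine mul_le_mul_right (setLIntegral_mono' measurableSet_Ioi fun t ht => ?_) p
        have ht : 0 < t := ht
        have h1 := superLevel_le_lintegral hn hC hT hφ hfm hp hp' hf hc hcK ht
        refine (mul_le_mul_right h1 _).trans_eq ?_
        have e : ENNReal.ofReal (t ^ (q - 2 - 1)) =
            ENNReal.ofReal (t ^ (q - 1)) * ENNReal.ofReal (t ^ (-2 : ℝ)) := by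
          rw [← ENNReal.ofReal_mul (by positivity), ← Real.rpow_add ht]
          congr 2; ring
        rw [e]; ring
    _ = p * (a * J) := by rw [lintegral_const_mul' _ _ ENNReal.ofReal_ne_top]
    _ = ENNReal.ofReal (strongConst q K c) * ∫⁻ x, ‖f x‖ₑ ^ q := by
        rw [hJ, strongConst, ENNReal.ofReal_mul (by positivity), ENNReal.ofReal_mul (by positivity),
          ENNReal.ofReal_mul (by linarith), ENNReal.ofReal_inv_of_pos hq2, hpq]
        ring

end

end TileEmbedding

end

open TileEmbedding

theorem theoremt (n : ℤ)
    (hn : ∀ P : Tile, ∀ x ∈ P.freq.dilate 1000, ∀ y ∈ (P.upper n).toSet, x < y) :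
    ∃ C₀ : ℝ, 1 ≤ C₀ ∧ ∀ A : ℕ → ℕ → ℝ,
      (∀ p : ℝ≥0∞, 2 < p → ∃ C : ℝ≥0,
        ∀ (T : Finset Tile) (φ : Tile → ℝ → ℂ), IsSparse C₀ T → IsWavePackets A T φ →
          ∀ f : ℝ → ℂ, MemLp f p volume →
            OuterLp.strongNorm (TileSpace.outerMeas n T) (TileSpace.generating n T)
                (TileSpace.sizeLac n T 2) p (waveCoeff T φ f) ≤
              C * eLpNorm f p volume) ∧
      (∃ C : ℝ≥0,
        ∀ (T : Finset Tile) (φ : Tile → ℝ → ℂ), IsSparse C₀ T → IsWavePackets A T φ →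
          ∀ f : ℝ → ℂ, MemLp f 2 volume →
            OuterLp.weakNorm (TileSpace.outerMeas n T) (TileSpace.generating n T)
                (TileSpace.sizeLac n T 2) 2 (waveCoeff T φ f) ≤
              C * eLpNorm f 2 volume) := by
  have hn' := gap_le n hn
  refine ⟨n + 100, by linarith, fun A => ⟨fun p hp => ?_, ?_⟩⟩
  · by_cases hp' : p = ∞
    · subst hp'
      refine ⟨(√bddConst * |A 0 6|).toNNReal, fun T φ hT hφ f hf => ?_⟩
      rw [OuterLp.strongNorm, if_pos rfl]
      exact strongNorm_top_le hn' le_rfl hT (fun P hP => hφ.isPacket hP) hf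
    · -- The truncation height `t / b` keeps the contribution of the bounded part below `t / 2`.
      set b := 2 * (√bddConst * |A 0 6| + 1)
      have hb : 0 < b := by positivity
      have hcK : 4 * bddConst * A 0 6 ^ 2 * b⁻¹ ^ 2 ≤ 1 := by
        have e : 4 * bddConst * A 0 6 ^ 2 = (2 * (√bddConst * |A 0 6|)) ^ 2 := by
          rw [mul_pow, mul_pow, Real.sq_sqrt bddConst_nonneg, sq_abs]; ring
        rw [e, ← mul_pow, ← div_eq_mul_inv]
        refine pow_le_one₀ (by positivity) ((div_le_one hb).2 ?_)
        simp only [b]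
        linarith
      refine ⟨(ENNReal.ofReal (strongConst p.toReal (A 0 6) b⁻¹) ^ (1 / p.toReal)).toNNReal,
        fun T φ hT hφ f hf => ?_⟩
      rw [ENNReal.coe_toNNReal (ENNReal.rpow_ne_top_of_nonneg (by positivity)
        ENNReal.ofReal_ne_top)]
      have hae := hf.1.ae_eq_mk
      have key := strongNorm_le_of_measurable hn' le_rfl hT (fun P hP => hφ.isPacket hP)
        hf.1.stronglyMeasurable_mk hp hp' (hf.ae_eq hae) (inv_pos.2 hb) hcK
      rwa [← waveCoeff_congr hae, ← eLpNorm_congr_ae hae] at key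
  · exact ⟨(√(2 * forestConst) * |A 0 6|).toNNReal, fun T φ hT hφ f hf =>
      weakNorm_two_le hn' le_rfl hT (fun P hP => hφ.isPacket hP) hf⟩
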